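/- An iterated function system (IFS) on a complete metric space $M$ is a nonempty finite set $F$ of contracting maps $M\to M$; its attractor is the unique nonempty compact set $A\subseteq M$ with $\bigcup_{f\in F} f(A)=A$. Let $S(F)$ be the semigroup generated by $F$ under composition. Its Cayley graph has vertex set $S(F)$ and, for all $s\in S(F)$ and $f\in F$, an edge from $s$ to $s\circ f$. A ray is an infinite oriented walk in this graph with pairwise distinct vertices. Two rays are equivalent if for every finite set $E$ of vertices they have subsequences lying in a common path component of the (unoriented) graph with $E$ removed. The equivalence classes are the ends of $F$, and $F$ is one-ended if it has exactly one end. Let $A\subset\mathbb{C}$ be the attractor of the IFS $\{a,b,c,d\}$ on $\mathbb{C}$, where $$a(z)=\tfrac{z}{3},\qquad b(z)=\tfrac{1+i}{3}z+\tfrac13,\qquad c(z)=-\tfrac{i}{3}z+\tfrac{2+i}{3},\qquad d(z)=\tfrac{z}{3}+\tfrac23 .$$ "Affine" means real affine on $\mathbb{C}=\mathbb{R}^2$. **Theorem 18.** (1) Let $f:\mathbb{C}\to\mathbb{C}$ be a map. Then $f$ is affine, satisfies $f(A)\subseteq A$, restricts to a contraction of $A$ (that is, there is $K<1$ with $|f(x)-f(y)|\le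 K|x-y|$ for all $x,y\in A$) and is not constant on $A$, if and only if $f$ is the composition of a nonempty word in $a,b,c,d$. (2) No IFS on $\mathbb{C}$ that consists of affine maps and has attractor $A$ is one-ended. -/

import Mathlib

open Set

/-- An iterated function system on a metric space `M`: a nonempty finite set of contracting
self-maps of `M`. -/
structure IFS (M : Type*) [MetricSpace M] where
  maps : Set (Function.End M)
  finite : maps.Finite
  nonempty : maps.Nonempty
  contracting : ∀ f ∈ maps, ∃ K : NNReal, ContractingWith K f

namespace IFS

/-! ### The attractor -/

section Attractor

variable {M : Type*} [MetricSpace M]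

/-- `A` is an attractor of `F`: a nonempty compact set which is the union of its images under the
maps of `F`. -/
structure IsAttractor (F : IFS M) (A : Set M) : Prop where
  nonempty : A.Nonempty
  isCompact : IsCompact A
  iUnion_image_eq : ⋃ f ∈ F.maps, f '' A = A

/-- The maps of an iterated function system have a common contraction factor. -/
theorem exists_factor (F : IFS M) :
    ∃ K : NNReal, K < 1 ∧ ∀ f ∈ F.maps, LipschitzWith K (f : M → M) := by
  choose! k hk using F.contracting
  have hlt : F.finite.toFinset.sup k < 1 := by
    rw [Finset.sup_lt_iff (by simp)]
    intro f hf
    exact (hk f (F.finite.mem_toFinset.1 hf)).1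
  refine ⟨F.finite.toFinset.sup k, hlt, fun f hf => ?_⟩
  exact (hk f hf).2.weaken (Finset.le_sup (f := k) (F.finite.mem_toFinset.2 hf))

/-- The operator `X ↦ ⋃ f ∈ F, f(X)` on nonempty compact sets. -/
def hutchinson (F : IFS M) (X : TopologicalSpace.NonemptyCompacts M) :
    TopologicalSpace.NonemptyCompacts M where
  carrier := ⋃ f ∈ F.maps, f '' (X : Set M)
  isCompact' := F.finite.isCompact_biUnion fun f hf => by
    obtain ⟨K, hK⟩ := F.contracting f hf
    exact X.isCompact.image hK.2.continuous
  nonempty' := by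
    obtain ⟨f, hf⟩ := F.nonempty
    obtain ⟨x, hx⟩ := X.nonempty
    exact ⟨f x, mem_biUnion hf ⟨x, hx, rfl⟩⟩

theorem exists_contractingWith_hutchinson (F : IFS M) :
    ∃ K : NNReal, ContractingWith K F.hutchinson := by
  obtain ⟨K, hK1, hK⟩ := F.exists_factor
  refine ⟨K, hK1, LipschitzWith.of_dist_le_mul fun X Y => ?_⟩
  have key : ∀ X Y : TopologicalSpace.NonemptyCompacts M,
      ∀ x ∈ F.hutchinson X, ∃ y ∈ F.hutchinson Y, dist x y ≤ K * dist X Y := by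
    intro X Y x hx
    obtain ⟨f, hf, u, hu, rfl⟩ := mem_iUnion₂.1 (show x ∈ ⋃ f ∈ F.maps, f '' (X : Set M) from hx)
    obtain ⟨v, hv, huv⟩ := Y.isCompact.exists_infDist_eq_dist Y.nonempty u
    have hfin : Metric.hausdorffEDist (X : Set M) Y ≠ ⊤ :=
      Metric.hausdorffEDist_ne_top_of_nonempty_of_bounded X.nonempty Y.nonempty
        X.isCompact.isBounded Y.isCompact.isBounded
    have h1 : dist u v ≤ dist X Y := by
      rw [← huv, Metric.NonemptyCompacts.dist_eq]
      exact Metric.infDist_le_hausdorffDist_of_mem hu hfin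
    refine ⟨f v, ?_, ?_⟩
    · change f v ∈ ⋃ f ∈ F.maps, f '' (Y : Set M)
      exact mem_biUnion hf ⟨v, hv, rfl⟩
    · exact ((hK f hf).dist_le_mul u v).trans (mul_le_mul_of_nonneg_left h1 K.2)
  rw [Metric.NonemptyCompacts.dist_eq]
  refine Metric.hausdorffDist_le_of_mem_dist (by positivity) (key X Y) fun y hy => ?_
  obtain ⟨x, hx, h⟩ := key Y X y hy
  exact ⟨x, hx, by rwa [dist_comm X Y]⟩

theorem existsUnique_isAttractor [CompleteSpace M] [Nonempty M] (F : IFS M) :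
    ∃! A : Set M, F.IsAttractor A := by
  obtain ⟨K, hK⟩ := F.exists_contractingWith_hutchinson
  have : Nonempty (TopologicalSpace.NonemptyCompacts M) := ⟨{Classical.arbitrary M}⟩
  refine ⟨(hK.fixedPoint F.hutchinson : TopologicalSpace.NonemptyCompacts M),
    ⟨TopologicalSpace.NonemptyCompacts.nonempty _, TopologicalSpace.NonemptyCompacts.isCompact _,
      congrArg (fun X : TopologicalSpace.NonemptyCompacts M => (X : Set M))
        hK.fixedPoint_isFixedPt⟩, fun B hB => ?_⟩
  let B' : TopologicalSpace.NonemptyCompacts M := ⟨⟨B, hB.isCompact⟩, hB.nonempty⟩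
  have hfix : Function.IsFixedPt F.hutchinson B' := SetLike.coe_injective hB.iUnion_image_eq
  exact congrArg (fun X : TopologicalSpace.NonemptyCompacts M => (X : Set M))
    (hK.fixedPoint_unique hfix)

/-- The attractor of an iterated function system on a nonempty complete metric space. -/
noncomputable def attractor [CompleteSpace M] [Nonempty M] (F : IFS M) : Set M :=
  F.existsUnique_isAttractor.choose

theorem isAttractor_attractor [CompleteSpace M] [Nonempty M] (F : IFS M) :
    F.IsAttractor F.attractor :=
  F.existsUnique_isAttractor.choose_spec.1

theorem IsAttractor.eq_attractor [CompleteSpace M] [Nonempty M] {F : IFS M} {A : Set M}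
    (hA : F.IsAttractor A) : A = F.attractor :=
  F.existsUnique_isAttractor.unique hA F.isAttractor_attractor

end Attractor

/-! ### The semigroup, its Cayley graph, and its ends -/

section Ends

variable {M : Type*} [MetricSpace M]

/-- The semigroup (under composition) generated by the maps of `F`: the maps that are given by
nonempty words in `F`. -/
def semigroup (F : IFS M) : Subsemigroup (Function.End M) :=
  Subsemigroup.closure F.maps

/-- The oriented edges of the Cayley graph: there is an edge from `s` to `s ∘ f` for every
`f ∈ F` (the multiplication of `Function.End M` is composition). -/
def Edge (F : IFS M) (s t : F.semigroup) : Prop :=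
  ∃ f ∈ F.maps, (t : Function.End M) = s * f

/-- The undirected graph underlying the Cayley graph (without its loops, which are irrelevant for
path components). -/
def cayleyGraph (F : IFS M) : SimpleGraph F.semigroup :=
  SimpleGraph.fromRel F.Edge

/-- A ray: an (oriented) walk in the Cayley graph whose vertices are all distinct. -/
structure Ray (F : IFS M) where
  vertex : ℕ → F.semigroup
  edge : ∀ n, F.Edge (vertex n) (vertex (n + 1))
  injective : Function.Injective vertex

/-- Two rays are equivalent if for every finite set `E` of vertices they have subsequences that lie
in a common path component of the complement of `E`. -/
def Ray.Equiv {F : IFS M} (r s : F.Ray) : Prop :=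
  ∀ E : Set F.semigroup, E.Finite →
    ∃ C : F.cayleyGraph.ComponentCompl E, ∃ φ ψ : ℕ → ℕ, StrictMono φ ∧ StrictMono ψ ∧
      (∀ n, r.vertex (φ n) ∈ C) ∧ ∀ n, s.vertex (ψ n) ∈ C

theorem Ray.eventually_mem {F : IFS M} (r : F.Ray) {E : Set F.semigroup} (hE : E.Finite) :
    ∃ (C : F.cayleyGraph.ComponentCompl E) (N : ℕ), ∀ n, N ≤ n → r.vertex n ∈ C := by
  have hfin : (r.vertex ⁻¹' E).Finite := hE.preimage r.injective.injOn
  obtain ⟨N, hN⟩ := hfin.bddAbove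
  have hout : ∀ n, N + 1 ≤ n → r.vertex n ∉ E := fun n hn hmem => by
    have : n ≤ N := hN hmem
    omega
  refine ⟨F.cayleyGraph.componentComplMk (hout (N + 1) le_rfl), N + 1, fun n hn => ?_⟩
  induction n, hn using Nat.le_induction with
  | base => exact SimpleGraph.componentComplMk_mem _ _
  | succ n hn ih =>
    obtain ⟨h1, h2⟩ := ih
    refine ⟨hout (n + 1) (by omega), ?_⟩
    rw [← h2]
    refine (SimpleGraph.componentComplMk_eq_of_adj _ _ _ ?_).symm
    rw [cayleyGraph, SimpleGraph.fromRel_adj]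
    exact ⟨fun h => by simpa using r.injective h, Or.inl (r.edge n)⟩

theorem Ray.equivalence (F : IFS M) : Equivalence (Ray.Equiv (F := F)) where
  refl r := fun E hE => by
    obtain ⟨C, N, hN⟩ := r.eventually_mem hE
    have hm : StrictMono fun n : ℕ => N + n := fun a b h => by simpa using h
    exact ⟨C, _, _, hm, hm, fun n => hN _ (by omega), fun n => hN _ (by omega)⟩
  symm h := fun E hE => by
    obtain ⟨C, φ, ψ, hφ, hψ, h1, h2⟩ := h E hE
    exact ⟨C, ψ, φ, hψ, hφ, h2, h1⟩
  trans {r s t} h h' := fun E hE => by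
    obtain ⟨C, φ, ψ, hφ, hψ, h1, h2⟩ := h E hE
    obtain ⟨C', φ', ψ', hφ', hψ', h1', h2'⟩ := h' E hE
    obtain ⟨D, N, hN⟩ := s.eventually_mem hE
    have uniq : ∀ {v : F.semigroup} {C₁ C₂ : F.cayleyGraph.ComponentCompl E},
        v ∈ C₁ → v ∈ C₂ → C₁ = C₂ := by
      rintro v C₁ C₂ ⟨_, rfl⟩ ⟨_, rfl⟩
      rfl
    have e1 : C = D := uniq (h2 N) (hN _ (hψ.id_le N))
    have e2 : C' = D := uniq (h1' N) (hN _ (hφ'.id_le N))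
    subst e1
    subst e2
    exact ⟨_, φ, ψ', hφ, hψ', h1, h2'⟩

/-- The setoid of rays. -/
def raySetoid (F : IFS M) : Setoid F.Ray := ⟨Ray.Equiv, Ray.equivalence F⟩

/-- The ends of an iterated function system: the equivalence classes of rays. -/
def Ends (F : IFS M) : Type _ := Quotient F.raySetoid

/-- The system has exactly one end. -/
def OneEnded (F : IFS M) : Prop := Nat.card F.Ends = 1

end Ends

end IFS

/-! ### The crooked Koch curve -/

/-- A self-map of the plane `ℂ = ℝ²` which is (real) affine. -/
def IsRealAffine (f : ℂ → ℂ) : Prop :=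
  ∃ φ : ℂ →ᵃ[ℝ] ℂ, (φ : ℂ → ℂ) = f

/-- `f` maps `A` into itself and its restriction to `A` is a contraction. -/
def IsContractionOf (A : Set ℂ) (f : ℂ → ℂ) : Prop :=
  MapsTo f A A ∧ ∃ K : NNReal, K < 1 ∧ LipschitzOnWith K f A

namespace CrookedKoch

noncomputable section

def a : Function.End ℂ := fun z => z / 3

def b : Function.End ℂ := fun z => (1 + Complex.I) / 3 * z + 1 / 3

def c : Function.End ℂ := fun z => -(Complex.I / 3) * z + (2 + Complex.I) / 3

def d : Function.End ℂ := fun z => z / 3 + 2 / 3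

theorem contracting_of_norm_lt_one (p q : ℂ) (hp : ‖p‖ < 1) (f : ℂ → ℂ)
    (hf : ∀ z, f z = p * z + q) : ∃ K : NNReal, ContractingWith K f := by
  refine ⟨‖p‖₊, by exact_mod_cast hp, LipschitzWith.of_dist_le_mul fun x y => ?_⟩
  rw [hf, hf, dist_add_right, dist_eq_norm, ← mul_sub, norm_mul, dist_eq_norm, coe_nnnorm]

/-- The iterated function system `{a, b, c, d}`. -/
def ifs : IFS ℂ where
  maps := {a, b, c, d}
  finite := by simp
  nonempty := ⟨a, by simp⟩
  contracting := by
    have hI : ‖1 + Complex.I‖ < 3 := by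
      refine (norm_add_le _ _).trans_lt ?_
      norm_num
    rintro f (rfl | rfl | rfl | rfl)
    · exact contracting_of_norm_lt_one (1 / 3) 0 (by norm_num) _ fun z => by simp [a]; ring
    · refine contracting_of_norm_lt_one ((1 + Complex.I) / 3) (1 / 3) ?_ _ fun z => rfl
      rw [norm_div, Complex.norm_ofNat]
      linarith
    · exact contracting_of_norm_lt_one (-(Complex.I / 3)) ((2 + Complex.I) / 3) (by norm_num) _
        fun z => rfl
    · exact contracting_of_norm_lt_one (1 / 3) (2 / 3) (by norm_num) _ fun z => by simp [d]; ring

/-- The crooked Koch curve. -/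
def curve : Set ℂ := ifs.attractor

end

end CrookedKoch

/-! The curve is a chain of four similar copies of itself from `0` to `1`; consecutive copies share
one junction point, which cuts the curve. The heart is rigidity: an affine map of the curve into
itself whose image lies on neither side of some junction is the identity (`Crosses.eq_id`). Any
other affine self-map sends the curve into a single piece (`exists_mapsTo_piece`). That piece can be
stripped off, which at least doubles distances, so a map that is not constant on the curve is a word
(`exists_isWord`); the empty word is no contraction.

Rigidity: a degenerate crossing map would put a segment through a corner of the curve
(`Crosses.injective`). An injective one is restricted to small copies of the curve, where the corner
shows that the point sent to the junction is a vertex of the convex hull. It is not `0` or `1`,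
since removing these does not disconnect the curve; so some copy has consecutive pieces on different
sides of the junction (`Crosses.exists_junctionCrosses`). On each side the curve looks like one of
two end models, whose boundary rays are respected by linear embeddings (`EndModel.linear_map`).
Comparing rays leaves homotheties by powers of `3`, and gaps in the curve leave only the identity
(`JunctionCrosses.eq_id`).

For the ends, every map in the semigroup of an affine system with this attractor takes the curve to
one side of `1/3`. Along an edge from `s` to `s ∘ f` the image shrinks, so the side changes only at
the constant map with value `1/3`. Removing this single vertex separates the powers of a map into
the left part from those of a map into the right part. -/

namespace CrookedKoch

/-! ### The pieces of the curve -/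

/-- The linear parts of the four maps, multiplied by `3`. -/
noncomputable def ratio : Fin 4 → ℂ := ![1, 1 + Complex.I, -Complex.I, 1]

noncomputable def shift : Fin 4 → ℂ := ![0, 1 / 3, (2 + Complex.I) / 3, 2 / 3]

/-- The four maps `a`, `b`, `c`, `d`, indexed by `Fin 4`. -/
noncomputable def piece (i : Fin 4) (z : ℂ) : ℂ := ratio i / 3 * z + shift i

theorem piece_zero : piece 0 = a := by
  funext z; simp [piece, ratio, shift, a]; ring

theorem piece_one : piece 1 = b := by
  funext z; simp [piece, ratio, shift, b]

theorem piece_two : piece 2 = c := by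
  funext z; simp [piece, ratio, shift, c]; ring

theorem piece_three : piece 3 = d := by
  funext z; simp [piece, ratio, shift, d]; ring

@[simp] theorem piece_zero_re (z : ℂ) : (piece 0 z).re = z.re / 3 := by
  simp [piece_zero, a]
@[simp] theorem piece_zero_im (z : ℂ) : (piece 0 z).im = z.im / 3 := by
  simp [piece_zero, a]
@[simp] theorem piece_one_re (z : ℂ) : (piece 1 z).re = (z.re - z.im + 1) / 3 := by
  simp [piece_one, b]; ring
@[simp] theorem piece_one_im (z : ℂ) : (piece 1 z).im = (z.re + z.im) / 3 := by
  simp [piece_one, b]; ring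
@[simp] theorem piece_two_re (z : ℂ) : (piece 2 z).re = (z.im + 2) / 3 := by
  simp [piece_two, c]; ring
@[simp] theorem piece_two_im (z : ℂ) : (piece 2 z).im = (1 - z.re) / 3 := by
  simp [piece_two, c]; ring
@[simp] theorem piece_three_re (z : ℂ) : (piece 3 z).re = (z.re + 2) / 3 := by
  simp [piece_three, d]; ring
@[simp] theorem piece_three_im (z : ℂ) : (piece 3 z).im = z.im / 3 := by
  simp [piece_three, d]

theorem ratio_ne_zero (i : Fin 4) : ratio i ≠ 0 := by
  fin_cases i <;> simp [ratio, Complex.ext_iff]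

theorem norm_ratio_le (i : Fin 4) : ‖ratio i / 3‖ ≤ 1 / 2 := by
  have h : ‖(1 + Complex.I : ℂ)‖ ≤ 3 / 2 := by
    rw [Complex.norm_def, Real.sqrt_le_left (by norm_num)]
    simp [Complex.normSq_apply]; norm_num
  rw [norm_div, Complex.norm_ofNat]
  fin_cases i <;> simp [ratio] <;> linarith

theorem piece_sub (i : Fin 4) (z w : ℂ) : piece i z - piece i w = ratio i / 3 * (z - w) := by
  simp only [piece]; ring

theorem dist_piece_le (i : Fin 4) (z w : ℂ) : dist (piece i z) (piece i w) ≤ dist z w / 2 := by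
  rw [dist_eq_norm, dist_eq_norm, piece_sub, norm_mul]
  nlinarith [norm_ratio_le i, norm_nonneg (z - w)]

theorem piece_injective (i : Fin 4) : Function.Injective (piece i) := by
  intro z w h
  have h' := piece_sub i z w
  rw [sub_eq_zero.2 h, eq_comm, mul_eq_zero, sub_eq_zero] at h'
  exact h'.resolve_left (div_ne_zero (ratio_ne_zero i) (by norm_num))

theorem continuous_piece (i : Fin 4) : Continuous (piece i) := by
  unfold piece; fun_prop

theorem piece_mem_maps (i : Fin 4) : piece i ∈ ifs.maps := by
  fin_cases i
  · exact Or.inl piece_zero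
  · exact Or.inr (Or.inl piece_one)
  · exact Or.inr (Or.inr (Or.inl piece_two))
  · exact Or.inr (Or.inr (Or.inr piece_three))

theorem mem_maps_iff {f : Function.End ℂ} : f ∈ ifs.maps ↔ ∃ i, f = piece i := by
  constructor
  · rintro (h | h | h | h)
    · exact ⟨0, h.trans piece_zero.symm⟩
    · exact ⟨1, h.trans piece_one.symm⟩
    · exact ⟨2, h.trans piece_two.symm⟩
    · exact ⟨3, h.trans piece_three.symm⟩
  · rintro ⟨i, rfl⟩
    exact piece_mem_maps i

theorem isCompact_curve : IsCompact curve := ifs.isAttractor_attractor.isCompact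

theorem curve_nonempty : curve.Nonempty := ifs.isAttractor_attractor.nonempty

theorem mem_curve_iff {z : ℂ} : z ∈ curve ↔ ∃ i, ∃ w ∈ curve, piece i w = z := by
  have h := ifs.isAttractor_attractor.iUnion_image_eq
  constructor
  · intro hz
    rw [curve, ← h] at hz
    obtain ⟨f, hf, w, hw, rfl⟩ := mem_iUnion₂.1 hz
    obtain ⟨i, rfl⟩ := mem_maps_iff.1 hf
    exact ⟨i, w, hw, rfl⟩
  · rintro ⟨i, w, hw, rfl⟩
    rw [curve, ← h]
    exact mem_biUnion (piece_mem_maps i) ⟨w, hw, rfl⟩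

theorem piece_mem {i : Fin 4} {z : ℂ} (hz : z ∈ curve) : piece i z ∈ curve :=
  mem_curve_iff.2 ⟨i, z, hz, rfl⟩

/-- A closed set that is invariant under the pieces contains the curve. -/
theorem curve_subset_of_invariant {Q : Set ℂ} (hQ : IsClosed Q) (hne : Q.Nonempty)
    (hinv : ∀ i, MapsTo (piece i) Q Q) : curve ⊆ Q := by
  -- A point of the curve farthest from `Q` is the image of a point at least twice as far from `Q`,
  -- so the maximal distance is zero.
  obtain ⟨x, hx, hmax⟩ := isCompact_curve.exists_isMaxOn curve_nonempty
    (Metric.continuous_infDist_pt Q).continuousOn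
  have hx0 : Metric.infDist x Q ≤ 0 := by
    obtain ⟨i, w, hw, rfl⟩ := mem_curve_iff.1 hx
    obtain ⟨q, hq, hwq⟩ := hQ.exists_infDist_eq_dist hne w
    have h1 : Metric.infDist (piece i w) Q ≤ dist w q / 2 :=
      (Metric.infDist_le_dist_of_mem (hinv i hq)).trans (dist_piece_le i w q)
    have h2 : Metric.infDist w Q ≤ Metric.infDist (piece i w) Q := hmax hw
    linarith
  intro z hz
  have hz' : Metric.infDist z Q ≤ Metric.infDist x Q := hmax hz
  exact (hQ.mem_iff_infDist_zero hne).2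
    (le_antisymm (hz'.trans hx0) Metric.infDist_nonneg)

theorem mem_curve_of_piece_eq {i : Fin 4} {z : ℂ} (h : piece i z = z) : z ∈ curve := by
  obtain ⟨q, hq, hzq⟩ := isCompact_curve.isClosed.exists_infDist_eq_dist curve_nonempty z
  have h1 : Metric.infDist z curve ≤ dist z q / 2 := by
    have := dist_piece_le i z q
    rw [h] at this
    exact (Metric.infDist_le_dist_of_mem (piece_mem hq)).trans this
  have h2 : 0 ≤ Metric.infDist z curve := Metric.infDist_nonneg
  exact (isCompact_curve.isClosed.mem_iff_infDist_zero curve_nonempty).2 (by linarith)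

theorem piece_zero_zero : piece 0 0 = 0 := by apply Complex.ext <;> simp

theorem piece_three_one : piece 3 1 = 1 := by
  apply Complex.ext <;> norm_num

theorem zero_mem_curve : (0 : ℂ) ∈ curve := mem_curve_of_piece_eq piece_zero_zero

theorem one_mem_curve : (1 : ℂ) ∈ curve := mem_curve_of_piece_eq piece_three_one

/-- The four half-planes that cut out the convex hull of the curve. -/
theorem curve_bounds {z : ℂ} (hz : z ∈ curve) :
    0 ≤ z.im ∧ 4 * z.im ≤ 3 * z.re ∧ z.im ≤ 1 / 3 ∧ z.re + z.im ≤ 1 := by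
  let Q : Set ℂ := {z | 0 ≤ z.im ∧ 4 * z.im ≤ 3 * z.re ∧ z.im ≤ 1 / 3 ∧ z.re + z.im ≤ 1}
  have hQ : IsClosed Q := by
    simp only [Q, Set.ofPred_and]
    refine IsClosed.inter ?_ (IsClosed.inter ?_ (IsClosed.inter ?_ ?_)) <;>
      exact isClosed_le (by fun_prop) (by fun_prop)
  refine curve_subset_of_invariant hQ ⟨0, by simp [Q]⟩ ?_ hz
  rintro i z ⟨h1, h2, h3, h4⟩
  fin_cases i <;> simp [Q] <;> refine ⟨?_, ?_, ?_, ?_⟩ <;> linarith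

/-- The junction points `1/3`, `(2 + i)/3`, `2/3` of consecutive pieces. -/
noncomputable def junction (j : Fin 3) : ℂ := piece j.succ 0

theorem piece_succ_zero (j : Fin 3) : piece j.succ 0 = junction j := rfl

theorem piece_castSucc_one (j : Fin 3) : piece j.castSucc 1 = junction j := by
  fin_cases j <;> apply Complex.ext <;> simp [junction]
  norm_num

theorem junction_mem (j : Fin 3) : junction j ∈ curve := piece_mem zero_mem_curve

theorem junction_zero_re : (junction 0).re = 1 / 3 := (piece_one_re 0).trans (by simp)
theorem junction_zero_im : (junction 0).im = 0 := (piece_one_im 0).trans (by simp)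
theorem junction_one_re : (junction 1).re = 2 / 3 := (piece_two_re 0).trans (by simp)
theorem junction_one_im : (junction 1).im = 1 / 3 := (piece_two_im 0).trans (by simp)
theorem junction_two_re : (junction 2).re = 2 / 3 := (piece_three_re 0).trans (by simp)
theorem junction_two_im : (junction 2).im = 0 := (piece_three_im 0).trans (by simp)

theorem norm_le_of_mem {z : ℂ} (hz : z ∈ curve) : ‖z‖ ≤ 4 / 3 := by
  obtain ⟨h1, h2, h3, h4⟩ := curve_bounds hz
  refine (Complex.norm_le_abs_re_add_abs_im z).trans ?_
  rw [abs_of_nonneg h1, abs_of_nonneg (by linarith)]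
  linarith

theorem dist_le_of_mem {z w : ℂ} (hz : z ∈ curve) (hw : w ∈ curve) : dist z w ≤ 2 := by
  obtain ⟨h1, h2, h3, h4⟩ := curve_bounds hz
  obtain ⟨g1, g2, g3, g4⟩ := curve_bounds hw
  rw [dist_eq_norm]
  refine (Complex.norm_le_abs_re_add_abs_im _).trans ?_
  have e1 : |(z - w).re| ≤ 1 := by rw [Complex.sub_re, abs_le]; constructor <;> linarith
  have e2 : |(z - w).im| ≤ 1 := by rw [Complex.sub_im, abs_le]; constructor <;> linarith
  linarith

theorem piece_zero_iterate (n : ℕ) (z : ℂ) : (piece 0)^[n] z = ((3 : ℝ)⁻¹ ^ n : ℝ) * z := by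
  induction n with
  | zero => simp
  | succ n ih =>
    rw [Function.iterate_succ_apply', ih]
    apply Complex.ext <;> simp [-Complex.ofReal_pow, -Complex.ofReal_inv] <;> ring

theorem piece_three_iterate (n : ℕ) (z : ℂ) :
    (piece 3)^[n] z = 1 + ((3 : ℝ)⁻¹ ^ n : ℝ) * (z - 1) := by
  induction n with
  | zero => simp
  | succ n ih =>
    rw [Function.iterate_succ_apply', ih]
    apply Complex.ext <;> simp [-Complex.ofReal_pow, -Complex.ofReal_inv] <;> ring

/-- The vertex `(4 + 3i)/9` of the convex hull of the curve. -/
noncomputable def tip : ℂ := piece 1 (junction 1)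

theorem tip_mem : tip ∈ curve := piece_mem (junction_mem 1)

theorem tip_re : tip.re = 4 / 9 := by
  rw [tip, piece_one_re, junction_one_re, junction_one_im]; norm_num
theorem tip_im : tip.im = 1 / 3 := by
  rw [tip, piece_one_im, junction_one_re, junction_one_im]; norm_num

/-- The curve meets the line `4y = 3x` only in `0` and the points `3⁻ᵐ (4 + 3i)/9`. -/
theorem exists_im_eq_pow_of_steep_of_lt {z : ℂ} (n : ℕ) (hz : z ∈ curve) (h : 4 * z.im = 3 * z.re)
    (hn : (3 : ℝ)⁻¹ ^ n < z.im) : ∃ m : ℕ, z.im = (3 : ℝ)⁻¹ ^ m * (1 / 3) := by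
  induction n generalizing z with
  | zero =>
    obtain ⟨h1, h2, h3, h4⟩ := curve_bounds hz
    norm_num at hn; linarith
  | succ n ih =>
    obtain ⟨i, w, hw, rfl⟩ := mem_curve_iff.1 hz
    obtain ⟨h1, h2, h3, h4⟩ := curve_bounds hw
    fin_cases i <;> simp [pow_succ] at h hn ⊢
    · obtain ⟨m, hm⟩ := ih hw (by linarith) (by rw [inv_pow]; linarith)
      exact ⟨m + 1, by rw [hm]; simp [pow_succ]; ring⟩
    -- The second piece touches the line only in its image of `junction 1`, at height `1/3`; the
    -- last two pieces lie strictly below the line.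
    · exact ⟨0, by simp; linarith⟩
    · linarith
    · linarith

/-- The curve meets the line `x + y = 1` only in `1` and the points `1 + 3⁻ᵐ (-1 + i)/3`. -/
theorem exists_im_eq_pow_of_antidiagonal_of_lt {z : ℂ} (n : ℕ) (hz : z ∈ curve) (h : z.re + z.im = 1)
    (hn : (3 : ℝ)⁻¹ ^ n < z.im) : ∃ m : ℕ, z.im = (3 : ℝ)⁻¹ ^ m * (1 / 3) := by
  induction n generalizing z with
  | zero =>
    obtain ⟨h1, h2, h3, h4⟩ := curve_bounds hz
    norm_num at hn; linarith
  | succ n ih =>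
    obtain ⟨i, w, hw, rfl⟩ := mem_curve_iff.1 hz
    obtain ⟨h1, h2, h3, h4⟩ := curve_bounds hw
    fin_cases i <;> simp [pow_succ] at h hn ⊢
    · linarith
    · exact ⟨0, by simp; linarith⟩
    · exact ⟨0, by simp; linarith⟩
    · obtain ⟨m, hm⟩ := ih hw (by linarith) (by rw [inv_pow]; linarith)
      exact ⟨m + 1, by rw [hm]; simp [pow_succ]; ring⟩

theorem exists_im_eq_pow_of_steep {z : ℂ} (hz : z ∈ curve) (h : 4 * z.im = 3 * z.re)
    (h0 : 0 < z.im) : ∃ m : ℕ, z.im = (3 : ℝ)⁻¹ ^ m * (1 / 3) := by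
  obtain ⟨n, hn⟩ := exists_pow_lt_of_lt_one h0 (show (3 : ℝ)⁻¹ < 1 by norm_num)
  exact exists_im_eq_pow_of_steep_of_lt n hz h hn

theorem exists_im_eq_pow_of_antidiagonal {z : ℂ} (hz : z ∈ curve) (h : z.re + z.im = 1)
    (h0 : 0 < z.im) : ∃ m : ℕ, z.im = (3 : ℝ)⁻¹ ^ m * (1 / 3) := by
  obtain ⟨n, hn⟩ := exists_pow_lt_of_lt_one h0 (show (3 : ℝ)⁻¹ < 1 by norm_num)
  exact exists_im_eq_pow_of_antidiagonal_of_lt n hz h hn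

/-! ### Intersections of pieces, and cut points -/

/-- Two different pieces meet only if they are consecutive, and then only in a junction point. -/
theorem piece_eq_piece {l k : Fin 4} (hlk : l < k) {z w : ℂ} (hz : z ∈ curve) (hw : w ∈ curve)
    (h : piece l z = piece k w) : (l : ℕ) + 1 = k ∧ z = 1 ∧ w = 0 := by
  have hre := congrArg Complex.re h
  have him := congrArg Complex.im h
  obtain ⟨h1, h2, h3, h4⟩ := curve_bounds hz
  obtain ⟨g1, g2, g3, g4⟩ := curve_bounds hw
  fin_cases l <;> fin_cases k <;> first | exact absurd hlk (by decide) | skip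
  all_goals
    simp at hre him
    first
    | exfalso; linarith
    | exact ⟨rfl, Complex.ext (by simp; linarith) (by simp; linarith),
        Complex.ext (by simp; linarith) (by simp; linarith)⟩

/-- `q` cuts the curve into the two closed parts `P ∋ 0` and `Q ∋ 1`. -/
structure IsCut (P Q : Set ℂ) (q : ℂ) : Prop where
  closed_left : IsClosed P
  closed_right : IsClosed Q
  union : ∀ z, z ∈ curve ↔ z ∈ P ∨ z ∈ Q
  inter : ∀ z, z ∈ P → z ∈ Q → z = q
  zero_mem : 0 ∈ P
  one_mem : 1 ∈ Q
  one_notMem : 1 ∉ P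
  zero_notMem : 0 ∉ Q

theorem isClosed_piece_image (i : Fin 4) {P : Set ℂ} (hP : IsClosed P) (hPc : P ⊆ curve) :
    IsClosed (piece i '' P) :=
  ((isCompact_curve.of_isClosed_subset hP hPc).image (continuous_piece i)).isClosed

/-- Distinct pieces share only images of endpoints, so every other point of a piece determines the
piece and its preimage. -/
theorem piece_mem_unique {l i : Fin 4} {z w : ℂ} (hz : z ∈ curve) (hw : w ∈ curve)
    (h : piece l z = piece i w) (hz0 : z ≠ 0) (hz1 : z ≠ 1) : l = i ∧ z = w := by
  rcases lt_trichotomy l i with hl | rfl | hl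
  · exact absurd (piece_eq_piece hl hz hw h).2.1 hz1
  · exact ⟨rfl, piece_injective l h⟩
  · exact absurd (piece_eq_piece hl hw hz h.symm).2.2 hz0

/-- The image of a cut under a piece, extended by the neighbouring pieces. -/
theorem IsCut.piece {P Q : Set ℂ} {q : ℂ} (h : IsCut P Q q) (i : Fin 4) :
    IsCut ((⋃ l, ⋃ _ : l < i, piece l '' curve) ∪ piece i '' P)
      (piece i '' Q ∪ ⋃ l, ⋃ _ : i < l, piece l '' curve) (piece i q) := by
  have hP : P ⊆ curve := fun z hz => (h.union z).2 (Or.inl hz)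
  have hQ : Q ⊆ curve := fun z hz => (h.union z).2 (Or.inr hz)
  have hcl : ∀ l : Fin 4, IsClosed (CrookedKoch.piece l '' curve) := fun l =>
    isClosed_piece_image l isCompact_curve.isClosed le_rfl
  refine ⟨?_, ?_, ?_, ?_, ?_, ?_, ?_, ?_⟩
  · exact (isClosed_iUnion_of_finite fun l => isClosed_iUnion_of_finite fun _ => hcl l).union
      (isClosed_piece_image i h.closed_left hP)
  · exact (isClosed_piece_image i h.closed_right hQ).union
      (isClosed_iUnion_of_finite fun l => isClosed_iUnion_of_finite fun _ => hcl l)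
  · intro z
    simp only [mem_union, mem_iUnion, mem_image, exists_prop]
    constructor
    · intro hz
      obtain ⟨l, w, hw, rfl⟩ := mem_curve_iff.1 hz
      rcases lt_trichotomy l i with hl | rfl | hl
      · exact Or.inl (Or.inl ⟨l, hl, w, hw, rfl⟩)
      · rcases (h.union w).1 hw with hw | hw
        · exact Or.inl (Or.inr ⟨w, hw, rfl⟩)
        · exact Or.inr (Or.inl ⟨w, hw, rfl⟩)
      · exact Or.inr (Or.inr ⟨l, hl, w, hw, rfl⟩)
    · rintro ((⟨l, -, w, hw, rfl⟩ | ⟨w, hw, rfl⟩) | (⟨w, hw, rfl⟩ | ⟨l, -, w, hw, rfl⟩))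
      exacts [piece_mem hw, piece_mem (hP hw), piece_mem (hQ hw), piece_mem hw]
  · simp only [mem_union, mem_iUnion, mem_image, exists_prop]
    -- Only `P` and `Q` inside the same piece can overlap: a neighbour meets piece `i` in an
    -- endpoint that lies in the other part of the cut, and pieces on opposite sides of `i` are not
    -- consecutive.
    rintro z (⟨l, hl, w, hw, rfl⟩ | ⟨w, hw, rfl⟩) (⟨v, hv, hvw⟩ | ⟨k, hk, v, hv, hvw⟩)
    · exact absurd ((piece_eq_piece hl hw (hQ hv) hvw.symm).2.2 ▸ hv) h.zero_notMem
    · have := (piece_eq_piece (hl.trans hk) hw hv hvw.symm).1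
      have h1 : (l : ℕ) < i := hl
      have h2 : (i : ℕ) < k := hk
      omega
    · rw [h.inter w hw (piece_injective i hvw ▸ hv)]
    · exact absurd ((piece_eq_piece hk (hP hw) hv hvw.symm).2.1 ▸ hw) h.one_notMem
  · simp only [mem_union, mem_iUnion, mem_image, exists_prop]
    rcases (Fin.zero_le i).eq_or_lt with rfl | hi
    · exact Or.inr ⟨0, h.zero_mem, piece_zero_zero⟩
    · exact Or.inl ⟨0, hi, 0, zero_mem_curve, piece_zero_zero⟩
  · simp only [mem_union, mem_iUnion, mem_image, exists_prop]
    rcases (Fin.le_last i).eq_or_lt with rfl | hi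
    · exact Or.inl ⟨1, h.one_mem, piece_three_one⟩
    · exact Or.inr ⟨3, hi, 1, one_mem_curve, piece_three_one⟩
  · have key : ∀ l : Fin 4, l < 3 → ∀ w ∈ curve, CrookedKoch.piece l w ≠ 1 := fun l hl w hw hlw =>
      one_ne_zero (piece_eq_piece hl hw one_mem_curve (hlw.trans piece_three_one.symm)).2.2
    simp only [mem_union, mem_iUnion, mem_image, exists_prop]
    rintro (⟨l, hl, w, hw, hlw⟩ | ⟨w, hw, hlw⟩)
    · exact key l (hl.trans_le (Fin.le_last i)) w hw hlw
    · rcases (Fin.le_last i).eq_or_lt with rfl | hi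
      · exact h.one_notMem (piece_injective 3 (hlw.trans piece_three_one.symm) ▸ hw)
      · exact key i hi w (hP hw) hlw
  · have key : ∀ l : Fin 4, 0 < l → ∀ w ∈ curve, CrookedKoch.piece l w ≠ 0 := fun l hl w hw hlw =>
      zero_ne_one (piece_eq_piece hl zero_mem_curve hw (piece_zero_zero.trans hlw.symm)).2.1
    simp only [mem_union, mem_iUnion, mem_image, exists_prop]
    rintro (⟨w, hw, hlw⟩ | ⟨l, hl, w, hw, hlw⟩)
    · rcases (Fin.zero_le i).eq_or_lt with rfl | hi
      · exact h.zero_notMem (piece_injective 0 (hlw.trans piece_zero_zero.symm) ▸ hw)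
      · exact key i hi w (hQ hw) hlw
    · exact key l ((Fin.zero_le i).trans_lt hl) w hw hlw

/-- The part of the curve before a junction. -/
def leftPart (j : Fin 3) : Set ℂ := ⋃ l, ⋃ _ : l ≤ j.castSucc, piece l '' curve

/-- The part of the curve after a junction. -/
def rightPart (j : Fin 3) : Set ℂ := ⋃ l, ⋃ _ : j.succ ≤ l, piece l '' curve

theorem mem_leftPart {j : Fin 3} {z : ℂ} :
    z ∈ leftPart j ↔ ∃ l ≤ j.castSucc, ∃ w ∈ curve, piece l w = z := by
  simp [leftPart]

theorem mem_rightPart {j : Fin 3} {z : ℂ} :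
    z ∈ rightPart j ↔ ∃ l, j.succ ≤ l ∧ ∃ w ∈ curve, piece l w = z := by
  simp [rightPart]

theorem isCut_junction (j : Fin 3) : IsCut (leftPart j) (rightPart j) (junction j) := by
  have hcl : ∀ l : Fin 4, IsClosed (piece l '' curve) := fun l =>
    isClosed_piece_image l isCompact_curve.isClosed le_rfl
  have hlt : j.castSucc < j.succ := Fin.castSucc_lt_succ
  refine ⟨isClosed_iUnion_of_finite fun l => isClosed_iUnion_of_finite fun _ => hcl l,
    isClosed_iUnion_of_finite fun l => isClosed_iUnion_of_finite fun _ => hcl l,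
    ?_, ?_, ?_, ?_, ?_, ?_⟩
  · intro z
    rw [mem_leftPart, mem_rightPart, mem_curve_iff]
    constructor
    · rintro ⟨l, hl⟩
      rcases le_or_gt l j.castSucc with h | h
      · exact Or.inl ⟨l, h, hl⟩
      · exact Or.inr ⟨l, Fin.castSucc_lt_iff_succ_le.1 h, hl⟩
    · rintro (⟨l, -, hl⟩ | ⟨l, -, hl⟩) <;> exact ⟨l, hl⟩
  · simp only [mem_leftPart, mem_rightPart]
    rintro z ⟨l, hl, w, hw, rfl⟩ ⟨k, hk, v, hv, hvw⟩
    obtain ⟨h1, rfl, rfl⟩ := piece_eq_piece (hl.trans_lt (hlt.trans_le hk)) hw hv hvw.symm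
    have h2 : (l : ℕ) ≤ j := hl
    have h3 : (j : ℕ) + 1 ≤ k := hk
    have h4 : l = j.castSucc := Fin.ext (by simp; omega)
    rw [h4, piece_castSucc_one]
  · exact mem_leftPart.2 ⟨0, Fin.zero_le _, 0, zero_mem_curve, piece_zero_zero⟩
  · exact mem_rightPart.2 ⟨3, Fin.le_last _, 1, one_mem_curve, piece_three_one⟩
  · rw [mem_leftPart]
    rintro ⟨l, hl, w, hw, hlw⟩
    exact one_ne_zero (piece_eq_piece (hl.trans_lt (hlt.trans_le (Fin.le_last j.succ))) hw
      one_mem_curve (hlw.trans piece_three_one.symm)).2.2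
  · rw [mem_rightPart]
    rintro ⟨l, hl, w, hw, hlw⟩
    exact zero_ne_one (piece_eq_piece (((Fin.zero_le j.castSucc).trans_lt hlt).trans_le hl)
      zero_mem_curve hw (piece_zero_zero.trans hlw.symm)).2.1

/-- A cut point belongs to every connected part of the curve that meets both sides. -/
theorem IsCut.mem_of_isPreconnected {P Q S : Set ℂ} {q : ℂ} (h : IsCut P Q q) (hS : S ⊆ curve)
    (hpre : IsPreconnected S) {x y : ℂ} (hx : x ∈ S) (hxP : x ∈ P) (hy : y ∈ S) (hyQ : y ∈ Q) :
    q ∈ S := by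
  obtain ⟨z, hz, hzP, hzQ⟩ := isPreconnected_closed_iff.1 hpre P Q h.closed_left h.closed_right
    (fun z hz => (h.union z).1 (hS hz)) ⟨x, hx, hxP⟩ ⟨y, hy, hyQ⟩
  exact h.inter z hzP hzQ ▸ hz

/-! ### Connectedness -/

/-- Two disjoint closed parts would have distance greater than some `r > 0`. Copies of the curve of
diameter at most `r` lie in one part, and since consecutive copies share a junction, this passes up
to larger and larger copies. -/
theorem isPreconnected_curve : IsPreconnected curve := by
  rw [isPreconnected_closed_iff]
  rintro t t' ht ht' hsub ⟨x, hx, hxt⟩ ⟨y, hy, hyt⟩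
  by_contra hempty
  have hdisj : ∀ z ∈ curve, z ∈ t → z ∉ t' := fun z hz h1 h2 => hempty ⟨z, hz, h1, h2⟩
  obtain ⟨r, hr, hsep⟩ := Metric.exists_pos_forall_lt_edist (isCompact_curve.inter_right ht)
    (isCompact_curve.inter_right ht').isClosed
    (disjoint_left.2 fun z hz hz' => hdisj z hz.1 hz.2 hz'.2)
  have hsep' : ∀ z ∈ curve, ∀ w ∈ curve, z ∈ t → w ∈ t' → (r : ℝ) < dist z w := by
    intro z hz w hw hzt hwt
    have := hsep z ⟨hz, hzt⟩ w ⟨hw, hwt⟩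
    rw [edist_nndist] at this
    exact_mod_cast this
  have key : ∀ (n : ℕ) (f : ℂ → ℂ) (K : ℝ), MapsTo f curve curve → K * 2 ≤ 2 ^ n * r →
      0 ≤ K → (∀ z w, dist (f z) (f w) ≤ K * dist z w) →
      MapsTo f curve t ∨ MapsTo f curve t' := by
    intro n
    induction n with
    | zero =>
      intro f K hf hK hK0 hlip
      rcases hsub (hf zero_mem_curve) with h0 | h0
      · refine Or.inl fun z hz => (hsub (hf hz)).resolve_right fun h => ?_
        have h1 := hsep' _ (hf zero_mem_curve) _ (hf hz) h0 h
        have h2 := hlip 0 z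
        have h3 := dist_le_of_mem zero_mem_curve hz
        nlinarith
      · refine Or.inr fun z hz => (hsub (hf hz)).resolve_left fun h => ?_
        have h1 := hsep' _ (hf hz) _ (hf zero_mem_curve) h h0
        have h2 := hlip z 0
        have h3 := dist_le_of_mem hz zero_mem_curve
        nlinarith
    | succ n ih =>
      intro f K hf hK hK0 hlip
      have hp : ∀ i, MapsTo (f ∘ piece i) curve t ∨ MapsTo (f ∘ piece i) curve t' := fun i =>
        ih (f ∘ piece i) (K / 2) (fun z hz => hf (piece_mem hz)) (by rw [pow_succ] at hK; linarith)
          (by linarith) fun z w => (hlip _ _).trans (by nlinarith [dist_piece_le i z w])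
      have step : ∀ j : Fin 3, (MapsTo (f ∘ piece j.castSucc) curve t ↔
          MapsTo (f ∘ piece j.succ) curve t) := by
        intro j
        have e : f (piece j.castSucc 1) = f (piece j.succ 0) :=
          congrArg f (piece_castSucc_one j)
        constructor
        · intro h
          refine (hp _).resolve_right fun h' => hdisj _ (hf (piece_mem one_mem_curve))
            (h one_mem_curve) ?_
          rw [e]
          exact h' zero_mem_curve
        · intro h
          refine (hp _).resolve_right fun h' => hdisj _ (hf (piece_mem one_mem_curve)) ?_
            (h' one_mem_curve)
          rw [e]
          exact h zero_mem_curve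
      have s0 := step 0
      have s1 := step 1
      have s2 := step 2
      simp only [Fin.castSucc_zero, Fin.succ_zero_eq_one, Fin.reduceCastSucc,
        Fin.reduceSucc] at s0 s1 s2
      by_cases h0 : MapsTo (f ∘ piece 0) curve t
      · left
        intro z hz
        obtain ⟨i, w, hw, rfl⟩ := mem_curve_iff.1 hz
        have : MapsTo (f ∘ piece i) curve t := by fin_cases i <;> simp <;> tauto
        exact this hw
      · right
        intro z hz
        obtain ⟨i, w, hw, rfl⟩ := mem_curve_iff.1 hz
        have : MapsTo (f ∘ piece i) curve t' := by
          refine (hp i).resolve_left ?_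
          fin_cases i <;> simp <;> tauto
        exact this hw
  obtain ⟨n, hn⟩ := exists_nat_ge (2 / (r : ℝ))
  have hr' : (0 : ℝ) < r := hr
  have hn' : (1 : ℝ) * 2 ≤ 2 ^ n * r := by
    have h1 : (n : ℝ) ≤ 2 ^ n := by exact_mod_cast Nat.lt_two_pow_self.le
    rw [div_le_iff₀ hr'] at hn
    nlinarith
  rcases key n id 1 (mapsTo_id _) hn' zero_le_one (fun z w => by simp) with h | h
  · exact hdisj y hy (h hy) hyt
  · exact hdisj x hx hxt (h hx)

/-- If the curve is the union of a piece `i` and a connected set that avoids the fixed point of this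
piece but meets its own image, then the curve without the fixed point is connected. -/
theorem isPreconnected_diff_fixedPoint {i : Fin 4} {e : ℂ} (he : piece i e = e) {B : Set ℂ}
    (hB : IsPreconnected B) (heB : e ∉ B) (hunion : curve = piece i '' curve ∪ B)
    (hne : (B ∩ piece i '' B).Nonempty) : IsPreconnected (curve \ {e}) := by
  have hBc : B ⊆ curve := hunion ▸ subset_union_right
  have hec : e ∈ curve := mem_curve_of_piece_eq he
  have hfix : ∀ n, (piece i)^[n] e = e := fun n => Function.iterate_fixed he n
  have hinj : ∀ n, Function.Injective ((piece i)^[n]) := fun n => (piece_injective i).iterate n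
  have hsub : ∀ n, MapsTo (piece i)^[n] curve curve := fun n =>
    MapsTo.iterate (fun z hz => piece_mem hz) n
  -- A point in no iterated image of `B` lies in all iterated images of the curve, and these shrink
  -- to `e`.
  have heq : curve \ {e} = ⋃ n, (piece i)^[n] '' B := by
    apply Subset.antisymm
    · rintro z ⟨hz, hze⟩
      by_contra hnot
      simp only [mem_iUnion, not_exists] at hnot
      have h : ∀ n, z ∈ (piece i)^[n] '' curve := by
        intro n
        induction n with
        | zero => simpa using hz
        | succ n ih =>
          obtain ⟨w, hw, hwz⟩ := ih
          rw [hunion] at hw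
          rcases hw with ⟨v, hv, rfl⟩ | hw
          · exact ⟨v, hv, by rw [Function.iterate_succ_apply, hwz]⟩
          · exact absurd ⟨w, hw, hwz⟩ (hnot n)
      have hd : ∀ n w, dist ((piece i)^[n] w) ((piece i)^[n] e) ≤ (1 / 2) ^ n * dist w e := by
        intro n w
        induction n with
        | zero => simp
        | succ n ih =>
          rw [Function.iterate_succ_apply', Function.iterate_succ_apply']
          refine (dist_piece_le i _ _).trans ?_
          rw [pow_succ]; linarith
      have hpos : 0 < dist z e := dist_pos.2 hze
      obtain ⟨n, hn⟩ := exists_pow_lt_of_lt_one (half_pos hpos) (show (1 / 2 : ℝ) < 1 by norm_num)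
      obtain ⟨w, hw, rfl⟩ := h n
      have h1 := hd n w
      have h2 := dist_le_of_mem hw hec
      rw [hfix] at h1
      have h3 : (0 : ℝ) < (1 / 2) ^ n := by positivity
      nlinarith
    · refine iUnion_subset fun n => ?_
      rintro _ ⟨w, hw, rfl⟩
      refine ⟨hsub n (hBc hw), fun h => heB ?_⟩
      have : w = e := hinj n ((mem_singleton_iff.1 h).trans (hfix n).symm)
      exact this ▸ hw
  rw [heq]
  refine IsPreconnected.iUnion_of_chain
    (fun n => hB.image _ ((continuous_piece i).iterate n).continuousOn) fun n => ?_
  obtain ⟨z, hz, w, hw, rfl⟩ := hne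
  refine ⟨(piece i)^[n] (piece i w), ⟨_, hz, rfl⟩, w, hw, ?_⟩
  exact Function.iterate_succ_apply _ _ _

theorem isPreconnected_piece_image (i : Fin 4) : IsPreconnected (piece i '' curve) :=
  isPreconnected_curve.image _ (continuous_piece i).continuousOn

theorem junction_mem_left (j : Fin 3) : junction j ∈ piece j.castSucc '' curve :=
  ⟨1, one_mem_curve, piece_castSucc_one j⟩

theorem junction_mem_right (j : Fin 3) : junction j ∈ piece j.succ '' curve :=
  ⟨0, zero_mem_curve, rfl⟩

/-- Unlike the junctions, the endpoints are not cut points. Hence an injective crossing map cannot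
send an endpoint to the junction (`Crosses.ne_endpoint`). -/
theorem isPreconnected_curve_diff_zero : IsPreconnected (curve \ {0}) := by
  refine isPreconnected_diff_fixedPoint (i := 0) piece_zero_zero
    (B := piece 1 '' curve ∪ (piece 2 '' curve ∪ piece 3 '' curve)) ?_ ?_ ?_ ?_
  · exact (isPreconnected_piece_image 1).union' ⟨_, junction_mem_left 1, Or.inl (junction_mem_right 1)⟩
      ((isPreconnected_piece_image 2).union' ⟨_, junction_mem_left 2, junction_mem_right 2⟩
        (isPreconnected_piece_image 3))
  · intro h
    apply (isCut_junction 0).zero_notMem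
    rcases h with ⟨w, hw, h⟩ | ⟨w, hw, h⟩ | ⟨w, hw, h⟩
    · exact mem_rightPart.2 ⟨1, by decide, w, hw, h⟩
    · exact mem_rightPart.2 ⟨2, by decide, w, hw, h⟩
    · exact mem_rightPart.2 ⟨3, by decide, w, hw, h⟩
  · ext z
    rw [mem_curve_iff, Fin.exists_fin_succ, Fin.exists_fin_succ, Fin.exists_fin_two]
    rfl
  · exact ⟨junction 0, Or.inl (junction_mem_right 0), 1,
      Or.inr (Or.inr ⟨1, one_mem_curve, piece_three_one⟩), piece_castSucc_one 0⟩

theorem isPreconnected_curve_diff_one : IsPreconnected (curve \ {1}) := by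
  refine isPreconnected_diff_fixedPoint (i := 3) piece_three_one
    (B := piece 0 '' curve ∪ (piece 1 '' curve ∪ piece 2 '' curve)) ?_ ?_ ?_ ?_
  · exact (isPreconnected_piece_image 0).union' ⟨_, junction_mem_left 0, Or.inl (junction_mem_right 0)⟩
      ((isPreconnected_piece_image 1).union' ⟨_, junction_mem_left 1, junction_mem_right 1⟩
        (isPreconnected_piece_image 2))
  · intro h
    apply (isCut_junction 2).one_notMem
    rcases h with ⟨w, hw, h⟩ | ⟨w, hw, h⟩ | ⟨w, hw, h⟩
    · exact mem_leftPart.2 ⟨0, by decide, w, hw, h⟩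
    · exact mem_leftPart.2 ⟨1, by decide, w, hw, h⟩
    · exact mem_leftPart.2 ⟨2, by decide, w, hw, h⟩
  · ext z
    rw [mem_curve_iff, Fin.exists_fin_succ, Fin.exists_fin_succ, Fin.exists_fin_two]
    constructor
    · rintro (h | h | h | h)
      exacts [Or.inr (Or.inl h), Or.inr (Or.inr (Or.inl h)), Or.inr (Or.inr (Or.inr h)), Or.inl h]
    · rintro (h | h | h | h)
      exacts [Or.inr (Or.inr (Or.inr h)), Or.inl h, Or.inr (Or.inl h), Or.inr (Or.inr (Or.inl h))]
  · exact ⟨junction 2, Or.inr (Or.inr (junction_mem_left 2)), 0,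
      Or.inl ⟨0, zero_mem_curve, piece_zero_zero⟩, rfl⟩

/-! ### Real affine maps and their linear parts -/

/-- `L` is the linear part of `f`. -/
def HasLinearPart (f : ℂ → ℂ) (L : ℂ →ₗ[ℝ] ℂ) : Prop :=
  ∀ z w, f z - f w = L (z - w)

theorem isRealAffine_iff {f : ℂ → ℂ} : IsRealAffine f ↔ ∃ L, HasLinearPart f L := by
  constructor
  · rintro ⟨φ, rfl⟩
    exact ⟨φ.linear, fun z w => (φ.linearMap_vsub z w).symm⟩
  · rintro ⟨L, hL⟩
    refine ⟨AffineMap.mk' f L 0 fun z => ?_, rfl⟩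
    have := hL z 0
    simp only [vsub_eq_sub, vadd_eq_add, ← this, sub_add_cancel]

theorem HasLinearPart.apply {f : ℂ → ℂ} {L : ℂ →ₗ[ℝ] ℂ} (h : HasLinearPart f L) (z w : ℂ) :
    f z = f w + L (z - w) := by
  rw [← h]; ring

theorem HasLinearPart.comp {f g : ℂ → ℂ} {L M : ℂ →ₗ[ℝ] ℂ} (hf : HasLinearPart f L)
    (hg : HasLinearPart g M) : HasLinearPart (f ∘ g) (L ∘ₗ M) := fun z w => by
  simp [hf _ _, hg _ _]

theorem hasLinearPart_piece (i : Fin 4) :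
    HasLinearPart (piece i) (LinearMap.mulLeft ℝ (ratio i / 3)) := fun z w => by
  simp [piece_sub]

theorem HasLinearPart.of_piece_comp {f g : ℂ → ℂ} {L : ℂ →ₗ[ℝ] ℂ} {i : Fin 4}
    (hf : HasLinearPart f L) (h : ∀ z, piece i (g z) = f z) :
    HasLinearPart g (LinearMap.mulLeft ℝ (ratio i / 3)⁻¹ ∘ₗ L) := fun z w => by
  have h0 : ratio i / 3 ≠ 0 := div_ne_zero (ratio_ne_zero i) (by norm_num)
  rw [LinearMap.comp_apply, ← hf, ← h, ← h, piece_sub, LinearMap.mulLeft_apply,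
    inv_mul_cancel_left₀ h0]

theorem HasLinearPart.injective_iff {f : ℂ → ℂ} {L : ℂ →ₗ[ℝ] ℂ} (hf : HasLinearPart f L) :
    Function.Injective f ↔ ∀ v, L v = 0 → v = 0 := by
  constructor
  · intro h v hv
    have := hf v 0
    rw [sub_zero, hv, sub_eq_zero] at this
    exact h this
  · intro h z w hzw
    refine sub_eq_zero.1 (h _ ?_)
    rw [← hf, hzw, sub_self]

theorem HasLinearPart.continuous {f : ℂ → ℂ} {L : ℂ →ₗ[ℝ] ℂ} (hf : HasLinearPart f L) :
    Continuous f := by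
  have : f = fun z => f 0 + L z := funext fun z => by simpa using hf.apply z 0
  rw [this]
  exact continuous_const.add L.continuous_of_finiteDimensional

theorem linearMap_apply_eq (L : ℂ →ₗ[ℝ] ℂ) (z : ℂ) : L z = z.re • L 1 + z.im • L Complex.I := by
  conv_lhs => rw [← Complex.re_add_im z]
  rw [map_add, ← map_smul, ← map_smul]
  congr 2
  simp

/-! ### The two ends of the curve -/

/-- The properties of the curve near one of its endpoints, translated to `0`, that restrict its
linear self-embeddings: it lies in the cone spanned by `e` and `u`, it has connected parts only
through points of both boundary rays, and it meets the ray of `u` only in points `3⁻ⁿ u`. -/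
structure EndModel (S : Set ℂ) (e u : ℂ) : Prop where
  isPreconnected : IsPreconnected S
  zero_mem : 0 ∈ S
  e_mem : e ∈ S
  u_mem : u ∈ S
  two_thirds_mem : (2 / 3 : ℝ) • e ∈ S
  cone : ∀ z ∈ S, ∃ α β : ℝ, 0 ≤ α ∧ 0 ≤ β ∧ z = α • e + β • u
  indep : ∀ α β : ℝ, α • e + β • u = 0 → α = 0 ∧ β = 0
  tip : ∀ r : ℝ, r ≠ 0 → r • u ∈ S → ∃ n : ℕ, r = 3⁻¹ ^ n
  cut : ∀ y ∈ S, y ≠ 0 → ∀ C ⊆ S, IsPreconnected C → 0 ∈ C → y ∈ C →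
    (∃ r : ℝ, r ≠ 0 ∧ r • e ∈ C) ∧ ∃ r : ℝ, r ≠ 0 ∧ r • u ∈ C

theorem EndModel.eq_of_eq {S : Set ℂ} {e u : ℂ} (h : EndModel S e u) {α β γ δ : ℝ}
    (heq : α • e + β • u = γ • e + δ • u) : α = γ ∧ β = δ := by
  have := h.indep (α - γ) (β - δ) (by
    rw [sub_smul, sub_smul]
    linear_combination (exp := 1) heq)
  exact ⟨sub_eq_zero.1 this.1, sub_eq_zero.1 this.2⟩

/-- A linear embedding between two end models preserves the boundary rays, and on the rays of the
tips it acts by a power of `3`. -/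
theorem EndModel.linear_map {S S' : Set ℂ} {e u e' u' : ℂ} (h : EndModel S e u)
    (h' : EndModel S' e' u') {N : ℂ →ₗ[ℝ] ℂ} (hN : ∀ v, N v = 0 → v = 0) (hmaps : MapsTo N S S') :
    (∃ α : ℝ, 0 < α ∧ N e = α • e') ∧ ∃ n : ℕ, N u = (3⁻¹ ^ n : ℝ) • u' := by
  have he0 : e ≠ 0 := fun h0 => by
    have := h.indep 1 0 (by simp [h0])
    simp at this
  have hu0 : u ≠ 0 := fun h0 => by
    have := h.indep 0 1 (by simp [h0])
    simp at this
  -- The connected image of `S` joins `0` to `N e`, so it meets both boundary rays of the target. As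
  -- all coordinates are nonnegative, `N` must permute the extreme rays.
  obtain ⟨⟨r, hr, z, hz, hzr⟩, r', hr', z', hz', hzr'⟩ := h'.cut (N e) (hmaps h.e_mem)
    (fun h0 => he0 (hN _ h0)) (N '' S) (image_subset_iff.2 hmaps)
    (h.isPreconnected.image _ N.continuous_of_finiteDimensional.continuousOn)
    ⟨0, h.zero_mem, map_zero N⟩ ⟨e, h.e_mem, rfl⟩
  obtain ⟨α, β, hα, hβ, rfl⟩ := h.cone z hz
  obtain ⟨α', β', hα', hβ', rfl⟩ := h.cone z' hz'
  obtain ⟨x₁, y₁, hx₁, hy₁, h₁⟩ := h'.cone _ (hmaps h.e_mem)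
  obtain ⟨x₂, y₂, hx₂, hy₂, h₂⟩ := h'.cone _ (hmaps h.u_mem)
  rw [map_add, map_smul, map_smul, h₁, h₂] at hzr hzr'
  have k1 : α * x₁ + β * x₂ = r ∧ α * y₁ + β * y₂ = 0 := by
    apply h'.eq_of_eq
    rw [zero_smul, add_zero, ← hzr]
    module
  have k2 : α' * x₁ + β' * x₂ = 0 ∧ α' * y₁ + β' * y₂ = r' := by
    apply h'.eq_of_eq
    rw [zero_smul, zero_add, ← hzr']
    module
  have m1 := mul_nonneg hα hy₁
  have m2 := mul_nonneg hβ hy₂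
  have m3 := mul_nonneg hα' hx₁
  have m4 := mul_nonneg hβ' hx₂
  have z1 : α = 0 ∨ y₁ = 0 := mul_eq_zero.1 (by linarith [k1.2])
  have z2 : β = 0 ∨ y₂ = 0 := mul_eq_zero.1 (by linarith [k1.2])
  have z3 : α' = 0 ∨ x₁ = 0 := mul_eq_zero.1 (by linarith [k2.1])
  have z4 : β' = 0 ∨ x₂ = 0 := mul_eq_zero.1 (by linarith [k2.1])
  have n1 : ¬ (x₁ = 0 ∧ y₁ = 0) := fun ⟨a1, a2⟩ => he0 (hN _ (by rw [h₁, a1, a2]; simp))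
  have n2 : ¬ (x₂ = 0 ∧ y₂ = 0) := fun ⟨a1, a2⟩ => hu0 (hN _ (by rw [h₂, a1, a2]; simp))
  have n3 : ¬ (α = 0 ∧ β = 0) := fun ⟨a1, a2⟩ => hr (by rw [← k1.1, a1, a2]; ring)
  have n4 : ¬ (α' = 0 ∧ β' = 0) := fun ⟨a1, a2⟩ => hr' (by rw [← k2.2, a1, a2]; ring)
  have n5 : ¬ (y₁ = 0 ∧ y₂ = 0) := fun ⟨a1, a2⟩ => hr' (by rw [← k2.2, a1, a2]; ring)
  by_cases hy : y₁ = 0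
  · have hx₁0 : x₁ ≠ 0 := fun hx => n1 ⟨hx, hy⟩
    have hy₂0 : y₂ ≠ 0 := fun hy' => n5 ⟨hy, hy'⟩
    have hx₂0 : x₂ = 0 := z4.resolve_left fun hβ' => n4 ⟨z3.resolve_right hx₁0, hβ'⟩
    refine ⟨⟨x₁, lt_of_le_of_ne hx₁ (Ne.symm hx₁0), by rw [h₁, hy]; simp⟩, ?_⟩
    have e2 : N u = y₂ • u' := by rw [h₂, hx₂0]; simp
    obtain ⟨n, hn⟩ := h'.tip y₂ hy₂0 (e2 ▸ hmaps h.u_mem)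
    exact ⟨n, by rw [e2, hn]⟩
  · exfalso
    have hy₂0 : y₂ = 0 := z2.resolve_left fun hβ0 => n3 ⟨z1.resolve_right hy, hβ0⟩
    have hx₂0 : x₂ ≠ 0 := fun hx => n2 ⟨hx, hy₂0⟩
    have hx₁0 : x₁ = 0 := z3.resolve_left fun hα0 => n4 ⟨hα0, z4.resolve_right hx₂0⟩
    have e1 : N e = y₁ • u' := by rw [h₁, hx₁0]; simp
    obtain ⟨n, hn⟩ := h'.tip y₁ hy (e1 ▸ hmaps h.e_mem)
    -- If the rays were exchanged, `e` and `(2 / 3) • e` would both go to points `3⁻¹ ^ n • u'`; the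
    -- ratio `2 / 3` is impossible by parity.
    have e2 : N ((2 / 3 : ℝ) • e) = (2 / 3 * y₁) • u' := by rw [map_smul, e1, smul_smul]
    obtain ⟨m, hm⟩ := h'.tip (2 / 3 * y₁) (by positivity) (e2 ▸ hmaps h.two_thirds_mem)
    rw [hn, inv_pow, inv_pow] at hm
    have h3 : (2 : ℝ) * 3 ^ m = 3 ^ (n + 1) := by
      field_simp at hm
      rw [pow_succ]; linarith
    have h4 : 2 * 3 ^ m = 3 ^ (n + 1) := by exact_mod_cast h3
    have h5 : Odd (3 ^ (n + 1)) := Odd.pow (by decide)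
    rw [← h4] at h5
    exact (Nat.not_odd_iff_even.2 (even_two_mul _)) h5

/-- The cut is carried to `3⁻ⁿ q`, and its part at `0` shrinks to `0`, so any given nonzero point of
the curve ends up on the far side. -/
theorem IsCut.iterate_zero {P Q : Set ℂ} {q : ℂ} (h : IsCut P Q q) (n : ℕ) :
    ∃ P' Q', IsCut P' Q' ((CrookedKoch.piece 0)^[n] q) ∧
      P' ⊆ (CrookedKoch.piece 0)^[n] '' curve := by
  induction n with
  | zero => exact ⟨P, Q, h, fun z hz => ⟨z, (h.union z).2 (Or.inl hz), rfl⟩⟩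
  | succ n ih =>
    obtain ⟨P', Q', hc, hsub⟩ := ih
    refine ⟨_, _, (Function.iterate_succ_apply' (CrookedKoch.piece 0) n q).symm ▸ hc.piece 0, ?_⟩
    refine union_subset (iUnion₂_subset fun l hl => absurd hl (Fin.not_lt_zero l)) ?_
    rw [Function.iterate_succ', image_comp]
    exact image_mono hsub

theorem IsCut.iterate_three {P Q : Set ℂ} {q : ℂ} (h : IsCut P Q q) (n : ℕ) :
    ∃ P' Q', IsCut P' Q' ((CrookedKoch.piece 3)^[n] q) ∧
      Q' ⊆ (CrookedKoch.piece 3)^[n] '' curve := by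
  induction n with
  | zero => exact ⟨P, Q, h, fun z hz => ⟨z, (h.union z).2 (Or.inr hz), rfl⟩⟩
  | succ n ih =>
    obtain ⟨P', Q', hc, hsub⟩ := ih
    refine ⟨_, _, (Function.iterate_succ_apply' (CrookedKoch.piece 3) n q).symm ▸ hc.piece 3, ?_⟩
    refine union_subset ?_ (iUnion₂_subset fun l hl => absurd hl (Fin.le_last l).not_gt)
    rw [Function.iterate_succ', image_comp]
    exact image_mono hsub

theorem exists_pow_mul_lt {y : ℂ} (hy : y ≠ 0) : ∃ n : ℕ, (3 : ℝ)⁻¹ ^ n * 2 < ‖y‖ := by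
  obtain ⟨n, hn⟩ := exists_pow_lt_of_lt_one (half_pos (norm_pos_iff.2 hy))
    (show (3 : ℝ)⁻¹ < 1 by norm_num)
  exact ⟨n, by linarith⟩

/-- Every connected part of the curve that contains `0` and another point contains small copies of
every cut point. -/
theorem IsCut.exists_mem_of_zero_mem {P Q : Set ℂ} {q : ℂ} (h : IsCut P Q q) {C : Set ℂ}
    (hC : C ⊆ curve) (hpre : IsPreconnected C) (h0 : 0 ∈ C) {y : ℂ} (hy : y ∈ C) (hy0 : y ≠ 0) :
    ∃ n : ℕ, (3⁻¹ ^ n : ℝ) • q ∈ C := by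
  obtain ⟨n, hn⟩ := exists_pow_mul_lt hy0
  obtain ⟨P', Q', hc, hsub⟩ := h.iterate_zero n
  have hyP : y ∉ P' := fun hyP => by
    obtain ⟨w, hw, hwy⟩ := hsub hyP
    rw [piece_zero_iterate] at hwy
    rw [← hwy, norm_mul, Complex.norm_real, Real.norm_of_nonneg (by positivity)] at hn
    have h1 := norm_le_of_mem hw
    have h2 : (0 : ℝ) < 3⁻¹ ^ n := by positivity
    nlinarith
  have := hc.mem_of_isPreconnected hC hpre h0 hc.zero_mem hy
    (((hc.union y).1 (hC hy)).resolve_left hyP)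
  rw [piece_zero_iterate] at this
  exact ⟨n, by rwa [Complex.real_smul]⟩

theorem IsCut.exists_mem_of_one_mem {P Q : Set ℂ} {q : ℂ} (h : IsCut P Q q) {C : Set ℂ}
    (hC : C ⊆ curve) (hpre : IsPreconnected C) (h0 : 1 ∈ C) {y : ℂ} (hy : y ∈ C) (hy0 : y ≠ 1) :
    ∃ n : ℕ, 1 + (3⁻¹ ^ n : ℝ) • (q - 1) ∈ C := by
  obtain ⟨n, hn⟩ := exists_pow_mul_lt (sub_ne_zero.2 hy0)
  obtain ⟨P', Q', hc, hsub⟩ := h.iterate_three n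
  have hyP : y ∉ Q' := fun hyP => by
    obtain ⟨w, hw, hwy⟩ := hsub hyP
    rw [piece_three_iterate] at hwy
    rw [← hwy, add_sub_cancel_left, norm_mul, Complex.norm_real,
      Real.norm_of_nonneg (by positivity)] at hn
    have h1 := dist_le_of_mem hw one_mem_curve
    rw [dist_eq_norm] at h1
    have h2 : (0 : ℝ) < 3⁻¹ ^ n := by positivity
    nlinarith
  have := hc.mem_of_isPreconnected hC hpre hy
    (((hc.union y).1 (hC hy)).resolve_right hyP) h0 hc.one_mem
  rw [piece_three_iterate] at this
  exact ⟨n, by rwa [Complex.real_smul]⟩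

theorem isCut_tip : ∃ P Q, IsCut P Q tip := ⟨_, _, (isCut_junction 1).piece 1⟩

/-- The cone lies between the real axis and the line `4y = 3x`. The cut points `1/3` and `tip`, one
on each ray, provide `cut`. -/
theorem endModel_zero : EndModel curve 1 tip where
  isPreconnected := isPreconnected_curve
  zero_mem := zero_mem_curve
  e_mem := one_mem_curve
  u_mem := tip_mem
  two_thirds_mem := by
    convert junction_mem 2 using 1
    apply Complex.ext
    · rw [junction_two_re]; simp
    · rw [junction_two_im]; simp
  cone z hz := by
    obtain ⟨h1, h2, h3, h4⟩ := curve_bounds hz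
    refine ⟨z.re - 4 / 3 * z.im, 3 * z.im, by linarith, by linarith, ?_⟩
    apply Complex.ext <;> simp [tip_re, tip_im] <;> ring
  indep α β h := by
    have hre := congrArg Complex.re h
    have him := congrArg Complex.im h
    simp [tip_re, tip_im] at hre him
    subst him
    simpa using hre
  tip r hr hmem := by
    have h0 := (curve_bounds hmem).1
    simp only [Complex.real_smul, Complex.im_ofReal_mul, tip_im] at h0
    have hpos : 0 < r := lt_of_le_of_ne (by linarith) hr.symm
    obtain ⟨m, hm⟩ := exists_im_eq_pow_of_steep hmem
      (by simp [tip_re, tip_im]; ring) (by simp [tip_im, hpos])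
    simp only [Complex.real_smul, Complex.im_ofReal_mul, tip_im] at hm
    exact ⟨m, by linarith⟩
  cut y hy hy0 C hC hpre h0 hyC := by
    obtain ⟨n, hn⟩ := (isCut_junction 0).exists_mem_of_zero_mem hC hpre h0 hyC hy0
    obtain ⟨P, Q, hcut⟩ := isCut_tip
    obtain ⟨m, hm⟩ := hcut.exists_mem_of_zero_mem hC hpre h0 hyC hy0
    refine ⟨⟨3⁻¹ ^ n * (1 / 3), by positivity, ?_⟩, _, by positivity, hm⟩
    convert hn using 1
    rw [mul_smul]
    congr 1
    apply Complex.ext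
    · rw [junction_zero_re]; simp
    · rw [junction_zero_im]; simp

/-- Seen from `1`, the boundary rays point to `0` and to `(2 + i)/3`; the cut points on them are
`2/3` and `(2 + i)/3`. -/
theorem endModel_one : EndModel ((fun z => z - 1) '' curve) (-1) (junction 1 - 1) where
  isPreconnected := isPreconnected_curve.image _ (by fun_prop)
  zero_mem := ⟨1, one_mem_curve, sub_self 1⟩
  e_mem := ⟨0, zero_mem_curve, zero_sub 1⟩
  u_mem := ⟨_, junction_mem 1, rfl⟩
  two_thirds_mem := by
    refine ⟨_, junction_mem 0, ?_⟩
    apply Complex.ext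
    · simp [junction_zero_re]; norm_num
    · simp [junction_zero_im]
  cone := by
    rintro _ ⟨z, hz, rfl⟩
    obtain ⟨h1, h2, h3, h4⟩ := curve_bounds hz
    refine ⟨1 - z.re - z.im, 3 * z.im, by linarith, by linarith, ?_⟩
    apply Complex.ext <;> simp [junction_one_re, junction_one_im] <;> ring
  indep α β h := by
    have hre := congrArg Complex.re h
    have him := congrArg Complex.im h
    simp [junction_one_re, junction_one_im] at hre him
    subst him
    simpa using hre
  tip := by
    rintro r hr ⟨z, hz, hzr⟩
    have hre := congrArg Complex.re hzr
    have him := congrArg Complex.im hzr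
    simp [junction_one_re, junction_one_im] at hre him
    have h0 := (curve_bounds hz).1
    have hpos : 0 < r := lt_of_le_of_ne (by linarith) hr.symm
    obtain ⟨m, hm⟩ := exists_im_eq_pow_of_antidiagonal hz (by linarith) (by linarith)
    exact ⟨m, by linarith⟩
  cut y _ hy0 C hC hpre h0 hyC := by
    have hC' : (fun z => z + 1) '' C ⊆ curve := by
      rintro _ ⟨z, hz, rfl⟩
      obtain ⟨w, hw, rfl⟩ := hC hz
      simpa using hw
    have hpre' : IsPreconnected ((fun z => z + 1) '' C) := hpre.image _ (by fun_prop)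
    have key : ∀ {P Q : Set ℂ} {q : ℂ}, IsCut P Q q → ∃ n : ℕ, (3⁻¹ ^ n : ℝ) • (q - 1) ∈ C := by
      intro P Q q hq
      obtain ⟨n, z, hz, hzn⟩ := hq.exists_mem_of_one_mem hC' hpre' ⟨0, h0, zero_add 1⟩
        ⟨y, hyC, rfl⟩ (by simpa using hy0)
      refine ⟨n, ?_⟩
      have : z = (3⁻¹ ^ n : ℝ) • (q - 1) := by
        have h1 : z + 1 = _ := hzn
        rw [add_comm] at h1
        exact add_left_cancel h1
      rwa [← this]
    obtain ⟨n, hn⟩ := key (isCut_junction 2)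
    obtain ⟨m, hm⟩ := key (isCut_junction 1)
    refine ⟨⟨3⁻¹ ^ n * (1 / 3), by positivity, ?_⟩, _, by positivity, hm⟩
    convert hn using 1
    rw [mul_smul]
    congr 1
    apply Complex.ext
    · simp [junction_two_re]; norm_num
    · simp [junction_two_im]

open Filter Topology

/-! ### Maps that cross a junction -/

/-- The image of the curve under `h` lies on neither side of the junction `j`. -/
def Crosses (j : Fin 3) (h : ℂ → ℂ) : Prop :=
  ¬ MapsTo h curve (leftPart j) ∧ ¬ MapsTo h curve (rightPart j)

/-- `h` maps two consecutive pieces to different sides of the junction `j`. -/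
def JunctionCrosses (j : Fin 3) (h : ℂ → ℂ) : Prop :=
  ∃ i : Fin 3,
    (MapsTo (h ∘ piece i.castSucc) curve (leftPart j) ∧
      MapsTo (h ∘ piece i.succ) curve (rightPart j)) ∨
    (MapsTo (h ∘ piece i.castSucc) curve (rightPart j) ∧
      MapsTo (h ∘ piece i.succ) curve (leftPart j))

theorem mapsTo_of_pieces {h : ℂ → ℂ} {T : Set ℂ} (hT : ∀ i, MapsTo (h ∘ piece i) curve T) :
    MapsTo h curve T := by
  intro z hz
  obtain ⟨i, w, hw, rfl⟩ := mem_curve_iff.1 hz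
  exact hT i hw

theorem Crosses.exists_piece_or_junctionCrosses {j : Fin 3} {h : ℂ → ℂ} (hc : Crosses j h) :
    (∃ i, Crosses j (h ∘ piece i)) ∨ JunctionCrosses j h := by
  by_contra hcon
  rw [not_or] at hcon
  obtain ⟨h1, h2⟩ := hcon
  have hside : ∀ i, MapsTo (h ∘ piece i) curve (leftPart j) ∨
      MapsTo (h ∘ piece i) curve (rightPart j) := fun i => by
    by_contra hi
    exact h1 ⟨i, not_or.1 hi⟩
  have hstep : ∀ i : Fin 3,
      (MapsTo (h ∘ piece i.castSucc) curve (leftPart j) →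
        MapsTo (h ∘ piece i.succ) curve (leftPart j)) ∧
      (MapsTo (h ∘ piece i.castSucc) curve (rightPart j) →
        MapsTo (h ∘ piece i.succ) curve (rightPart j)) := fun i =>
    ⟨fun hl => (hside _).resolve_right fun hr => h2 ⟨i, Or.inl ⟨hl, hr⟩⟩,
      fun hr => (hside _).resolve_left fun hl => h2 ⟨i, Or.inr ⟨hr, hl⟩⟩⟩
  rcases hside 0 with h0 | h0
  · exact hc.1 (mapsTo_of_pieces fun i => by
      induction i using Fin.induction with
      | zero => exact h0
      | succ i ih => exact (hstep i).1 ih)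
  · exact hc.2 (mapsTo_of_pieces fun i => by
      induction i using Fin.induction with
      | zero => exact h0
      | succ i ih => exact (hstep i).2 ih)

/-- The composition of a word of length `n` in the four maps. -/
inductive IsWord : ℕ → (ℂ → ℂ) → Prop
  | nil : IsWord 0 id
  | cons {n : ℕ} {w : ℂ → ℂ} (i : Fin 4) : IsWord n w → IsWord (n + 1) (piece i ∘ w)

theorem IsWord.mapsTo {n : ℕ} {w : ℂ → ℂ} (hw : IsWord n w) : MapsTo w curve curve := by
  induction hw with
  | nil => exact mapsTo_id _
  | cons i _ ih => exact fun z hz => piece_mem (ih hz)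

theorem IsWord.injective {n : ℕ} {w : ℂ → ℂ} (hw : IsWord n w) : Function.Injective w := by
  induction hw with
  | nil => exact Function.injective_id
  | cons i _ ih => exact (piece_injective i).comp ih

theorem IsWord.hasLinearPart {n : ℕ} {w : ℂ → ℂ} (hw : IsWord n w) :
    ∃ L, HasLinearPart w L := by
  induction hw with
  | nil => exact ⟨LinearMap.id, fun z w => rfl⟩
  | cons i _ ih =>
    obtain ⟨L, hL⟩ := ih
    exact ⟨_, (hasLinearPart_piece i).comp hL⟩

theorem IsWord.dist_le {n : ℕ} {w : ℂ → ℂ} (hw : IsWord n w) (x y : ℂ) :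
    dist (w x) (w y) ≤ (1 / 2) ^ n * dist x y := by
  induction hw with
  | nil => simp
  | cons i _ ih =>
    refine (dist_piece_le i _ _).trans ?_
    rw [pow_succ]; linarith

theorem IsWord.append {n m : ℕ} {v w : ℂ → ℂ} (hv : IsWord n v) (hw : IsWord m w) :
    IsWord (n + m) (v ∘ w) := by
  induction hv with
  | nil => simpa using hw
  | cons i _ ih => exact add_right_comm _ 1 m ▸ ih.cons i

theorem isWord_piece (i : Fin 4) : IsWord 1 (piece i) := IsWord.nil.cons i

/-- As long as the junction does not separate two consecutive pieces, one of the pieces crosses it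
again, so crossing copies can be made arbitrarily small. -/
theorem Crosses.descend {j : Fin 3} {h : ℂ → ℂ} (hc : Crosses j h) (n : ℕ) :
    ∃ m w, IsWord m w ∧ (JunctionCrosses j (h ∘ w) ∨ (m = n ∧ Crosses j (h ∘ w))) := by
  induction n generalizing h with
  | zero => exact ⟨0, id, IsWord.nil, Or.inr ⟨rfl, hc⟩⟩
  | succ n ih =>
    rcases hc.exists_piece_or_junctionCrosses with ⟨i, hi⟩ | hj
    · obtain ⟨m, w, hw, hcase⟩ := ih hi
      refine ⟨m + 1, piece i ∘ w, hw.cons i, ?_⟩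
      rcases hcase with h1 | ⟨rfl, h1⟩
      · exact Or.inl h1
      · exact Or.inr ⟨rfl, h1⟩
    · exact ⟨0, id, IsWord.nil, Or.inl hj⟩

/-- A map of the curve into itself that crosses a junction takes values strictly on both sides. -/
theorem Crosses.exists_strict {j : Fin 3} {h : ℂ → ℂ} (hc : Crosses j h)
    (hmaps : MapsTo h curve curve) :
    (∃ x ∈ curve, h x ∈ leftPart j ∧ h x ≠ junction j) ∧
      ∃ y ∈ curve, h y ∈ rightPart j ∧ h y ≠ junction j := by
  obtain ⟨h1, h2⟩ := hc
  simp only [MapsTo, not_forall, exists_prop] at h1 h2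
  obtain ⟨y, hy, hyl⟩ := h1
  obtain ⟨x, hx, hxr⟩ := h2
  have hcut := isCut_junction j
  have hjl : junction j ∈ leftPart j :=
    mem_leftPart.2 ⟨_, le_rfl, 1, one_mem_curve, piece_castSucc_one j⟩
  have hjr : junction j ∈ rightPart j :=
    mem_rightPart.2 ⟨_, le_rfl, 0, zero_mem_curve, rfl⟩
  exact ⟨⟨x, hx, ((hcut.union _).1 (hmaps hx)).resolve_right hxr, fun h => hxr (h ▸ hjr)⟩,
    ⟨y, hy, ((hcut.union _).1 (hmaps hy)).resolve_left hyl, fun h => hyl (h ▸ hjl)⟩⟩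

/-- The connected image of `S` reaches both sides of a cut point. `S` may omit points sent to the
junction, so that an endpoint can be removed in `Crosses.ne_endpoint`. -/
theorem Crosses.exists_eq_junction {j : Fin 3} {h : ℂ → ℂ} (hc : Crosses j h)
    (hmaps : MapsTo h curve curve) (hcont : Continuous h) {S : Set ℂ} (hS : S ⊆ curve)
    (hpre : IsPreconnected S) (hall : ∀ z ∈ curve, h z ≠ junction j → z ∈ S) :
    ∃ t ∈ S, h t = junction j := by
  obtain ⟨⟨x, hx, hxl, hxj⟩, y, hy, hyr, hyj⟩ := hc.exists_strict hmaps
  obtain ⟨t, ht, htj⟩ := (isCut_junction j).mem_of_isPreconnected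
    (image_subset_iff.2 fun z hz => hmaps (hS hz)) (hpre.image h hcont.continuousOn)
    ⟨x, hall x hx hxj, rfl⟩ hxl ⟨y, hall y hy hyj, rfl⟩ hyr
  exact ⟨t, ht, htj⟩

/-- An injective map that crosses a junction does not map an endpoint of the curve to it. -/
theorem Crosses.ne_endpoint {j : Fin 3} {h : ℂ → ℂ} (hc : Crosses j h)
    (hmaps : MapsTo h curve curve) (hcont : Continuous h) (hinj : Function.Injective h) {t : ℂ}
    (htj : h t = junction j) : t ≠ 0 ∧ t ≠ 1 := by
  constructor
  · rintro rfl
    obtain ⟨s, hs, hsj⟩ := hc.exists_eq_junction hmaps hcont sdiff_subset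
      isPreconnected_curve_diff_zero fun z hz hzj => ⟨hz, fun h0 => hzj (by rw [h0, htj])⟩
    exact hs.2 (hinj (hsj.trans htj.symm))
  · rintro rfl
    obtain ⟨s, hs, hsj⟩ := hc.exists_eq_junction hmaps hcont sdiff_subset
      isPreconnected_curve_diff_one fun z hz hzj => ⟨hz, fun h0 => hzj (by rw [h0, htj])⟩
    exact hs.2 (hinj (hsj.trans htj.symm))

/-- A crossing piece would hit junction `j` from a point that is not an endpoint of the piece. By
injectivity this point is `junction i`, which is only ever an endpoint of pieces. -/
theorem Crosses.junctionCrosses_of_junction {j i : Fin 3} {h : ℂ → ℂ} (hc : Crosses j h)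
    (hmaps : MapsTo h curve curve) (hcont : Continuous h) (hinj : Function.Injective h)
    (htj : h (junction i) = junction j) : JunctionCrosses j h := by
  refine hc.exists_piece_or_junctionCrosses.resolve_left ?_
  rintro ⟨g, hg⟩
  have hmaps' : MapsTo (h ∘ piece g) curve curve := fun z hz => hmaps (piece_mem hz)
  have hcont' := hcont.comp (continuous_piece g)
  obtain ⟨t, ht, htj'⟩ := hg.exists_eq_junction hmaps' hcont' le_rfl isPreconnected_curve
    fun z hz _ => hz
  obtain ⟨h0, h1⟩ := hg.ne_endpoint hmaps' hcont' (hinj.comp (piece_injective g)) htj'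
  exact h0 (piece_mem_unique ht zero_mem_curve (hinj (htj'.trans htj.symm)) h0 h1).2

/-- The tip is the copy of `junction 1` in the piece `b`; if a piece still crosses, it is this one,
and the case of a junction applies to it. -/
theorem Crosses.junctionCrosses_of_tip {j : Fin 3} {h : ℂ → ℂ} (hc : Crosses j h)
    (hmaps : MapsTo h curve curve) (hcont : Continuous h) (hinj : Function.Injective h)
    (htj : h tip = junction j) : ∃ m w, IsWord m w ∧ JunctionCrosses j (h ∘ w) := by
  rcases hc.exists_piece_or_junctionCrosses with ⟨g, hg⟩ | hj
  · have hmaps' : MapsTo (h ∘ piece g) curve curve := fun z hz => hmaps (piece_mem hz)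
    have hcont' := hcont.comp (continuous_piece g)
    have hinj' := hinj.comp (piece_injective g)
    obtain ⟨t, ht, htj'⟩ := hg.exists_eq_junction hmaps' hcont' le_rfl isPreconnected_curve
      fun z hz _ => hz
    obtain ⟨h0, h1⟩ := hg.ne_endpoint hmaps' hcont' hinj' htj'
    obtain ⟨-, rfl⟩ := piece_mem_unique ht (junction_mem 1) (hinj (htj'.trans htj.symm)) h0 h1
    exact ⟨1, _, isWord_piece g, hg.junctionCrosses_of_junction hmaps' hcont' hinj' htj'⟩
  · exact ⟨0, id, IsWord.nil, hj⟩

/-! ### The corners at the junctions -/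

/-- The earlier pieces form a closed set that misses the junction. -/
theorem eventually_mem_piece_of_leftPart (j : Fin 3) :
    ∀ᶠ z in 𝓝 (junction j), z ∈ leftPart j → z ∈ piece j.castSucc '' curve := by
  have hcl : IsClosed (⋃ l, ⋃ _ : l < j.castSucc, piece l '' curve) :=
    isClosed_iUnion_of_finite fun l => isClosed_iUnion_of_finite fun _ =>
      isClosed_piece_image l isCompact_curve.isClosed le_rfl
  have hnot : junction j ∉ ⋃ l, ⋃ _ : l < j.castSucc, piece l '' curve := by
    simp only [mem_iUnion, not_exists]
    rintro l hl ⟨w, hw, hwj⟩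
    have h1 := (piece_eq_piece (hl.trans Fin.castSucc_lt_succ) hw zero_mem_curve hwj).1
    have h2 : (l : ℕ) < j := hl
    simp at h1
    omega
  filter_upwards [hcl.isOpen_compl.mem_nhds hnot] with z hz hzl
  obtain ⟨l, hl, w, hw, rfl⟩ := mem_leftPart.1 hzl
  rcases hl.eq_or_lt with rfl | hl
  · exact ⟨w, hw, rfl⟩
  · exact (hz (mem_iUnion₂.2 ⟨l, hl, w, hw, rfl⟩)).elim

theorem eventually_mem_piece_of_rightPart (j : Fin 3) :
    ∀ᶠ z in 𝓝 (junction j), z ∈ rightPart j → z ∈ piece j.succ '' curve := by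
  have hcl : IsClosed (⋃ l, ⋃ _ : j.succ < l, piece l '' curve) :=
    isClosed_iUnion_of_finite fun l => isClosed_iUnion_of_finite fun _ =>
      isClosed_piece_image l isCompact_curve.isClosed le_rfl
  have hnot : junction j ∉ ⋃ l, ⋃ _ : j.succ < l, piece l '' curve := by
    simp only [mem_iUnion, not_exists]
    rintro l hl ⟨w, hw, hwj⟩
    have h1 := (piece_eq_piece (Fin.castSucc_lt_succ.trans hl) one_mem_curve hw
      ((piece_castSucc_one j).trans hwj.symm)).1
    have h2 : (j : ℕ) + 1 < l := hl
    simp at h1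
    omega
  filter_upwards [hcl.isOpen_compl.mem_nhds hnot] with z hz hzl
  obtain ⟨l, hl, w, hw, rfl⟩ := mem_rightPart.1 hzl
  rcases hl.eq_or_lt with rfl | hl
  · exact ⟨w, hw, rfl⟩
  · exact (hz (mem_iUnion₂.2 ⟨l, hl, w, hw, rfl⟩)).elim

/-- Near a junction the curve lies in a pointed cone. -/
theorem exists_supporting_functional (j : Fin 3) :
    ∃ α β : ℝ, ∀ᶠ z in 𝓝 (junction j), z ∈ curve → z ≠ junction j →
      0 < α * (z - junction j).re + β * (z - junction j).im := by
  have key : ∃ α β : ℝ, ∀ w ∈ curve,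
      (piece j.castSucc w ≠ junction j →
        0 < α * (piece j.castSucc w - junction j).re + β * (piece j.castSucc w - junction j).im) ∧
      (piece j.succ w ≠ junction j →
        0 < α * (piece j.succ w - junction j).re + β * (piece j.succ w - junction j).im) := by
    suffices h : ∃ α β : ℝ, ∀ w ∈ curve,
        (w ≠ 1 → 0 < α * (piece j.castSucc w - junction j).re +
          β * (piece j.castSucc w - junction j).im) ∧
        (w ≠ 0 → 0 < α * (piece j.succ w - junction j).re +
          β * (piece j.succ w - junction j).im) by
      obtain ⟨α, β, h⟩ := h
      refine ⟨α, β, fun w hw => ⟨fun hne => (h w hw).1 ?_, fun hne => (h w hw).2 ?_⟩⟩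
      · rintro rfl; exact hne (piece_castSucc_one j)
      · rintro rfl; exact hne rfl
    have one_side : ∀ w ∈ curve, w ≠ 1 → 0 < 1 - w.re := by
      intro w hw hne
      obtain ⟨h1, h2, h3, h4⟩ := curve_bounds hw
      refine lt_of_le_of_ne (by linarith) fun h => hne (Complex.ext ?_ ?_) <;> simp <;> linarith
    have zero_side : ∀ w ∈ curve, w ≠ 0 → 0 < w.re := by
      intro w hw hne
      obtain ⟨h1, h2, h3, h4⟩ := curve_bounds hw
      refine lt_of_le_of_ne (by linarith) fun h => hne (Complex.ext ?_ ?_) <;> simp <;> linarith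
    -- At each junction the coefficients define a functional that is positive on the cones of both
    -- adjacent pieces.
    fin_cases j
    · refine ⟨-1, 2, fun w hw => ?_⟩
      obtain ⟨h1, h2, h3, h4⟩ := curve_bounds hw
      refine ⟨fun hne => ?_, fun hne => ?_⟩
      · have := one_side w hw hne
        simp [junction_zero_re, junction_zero_im]; linarith
      · have := zero_side w hw hne
        simp [junction_zero_re, junction_zero_im]; linarith
    · refine ⟨-1, -2, fun w hw => ?_⟩
      obtain ⟨h1, h2, h3, h4⟩ := curve_bounds hw
      refine ⟨fun hne => ?_, fun hne => ?_⟩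
      · have := one_side w hw hne
        simp [junction_one_re, junction_one_im]; linarith
      · have := zero_side w hw hne
        simp [junction_one_re, junction_one_im]; linarith
    · refine ⟨1, 1, fun w hw => ?_⟩
      obtain ⟨h1, h2, h3, h4⟩ := curve_bounds hw
      refine ⟨fun hne => ?_, fun hne => ?_⟩
      · have := one_side w hw hne
        simp [junction_two_re, junction_two_im]; linarith
      · have := zero_side w hw hne
        simp [junction_two_re, junction_two_im]; linarith
  obtain ⟨α, β, h⟩ := key
  refine ⟨α, β, ?_⟩
  filter_upwards [eventually_mem_piece_of_leftPart j, eventually_mem_piece_of_rightPart j]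
    with z hl hr hz hne
  rcases ((isCut_junction j).union z).1 hz with hz | hz
  · obtain ⟨w, hw, rfl⟩ := hl hz
    exact (h w hw).1 hne
  · obtain ⟨w, hw, rfl⟩ := hr hz
    exact (h w hw).2 hne

/-- A point of the curve that is the unique minimum of a linear functional is a vertex of the
convex hull. -/
theorem eq_vertex_of_unique_min {t : ℂ} (ht : t ∈ curve) {A B : ℝ}
    (h : ∀ z ∈ curve, z ≠ t → 0 < A * (z.re - t.re) + B * (z.im - t.im)) :
    t = 0 ∨ t = 1 ∨ t = junction 1 ∨ t = tip := by
  by_contra hcon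
  simp only [not_or] at hcon
  obtain ⟨n0, n1, n2, n3⟩ := hcon
  have d0 := h 0 zero_mem_curve (Ne.symm n0)
  have d1 := h 1 one_mem_curve (Ne.symm n1)
  have d2 := h _ (junction_mem 1) (Ne.symm n2)
  have d3 := h _ tip_mem (Ne.symm n3)
  rw [junction_one_re, junction_one_im] at d2
  rw [tip_re, tip_im] at d3
  simp only [Complex.zero_re, Complex.zero_im, Complex.one_re, Complex.one_im] at d0 d1
  obtain ⟨h1, h2, h3, h4⟩ := curve_bounds ht
  have comb : ∀ {p q r x y z : ℝ}, 0 ≤ p → 0 ≤ q → 0 ≤ r → p + q + r = 1 → 0 < x → 0 < y → 0 < z →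
      p * x + q * y + r * z = 0 → False := by
    intro p q r x y z hp hq hr hs hx hy hz h0
    have e1 := mul_nonneg hp hx.le
    have e2 := mul_nonneg hq hy.le
    have e3 := mul_nonneg hr hz.le
    have f1 := (mul_eq_zero.1 (show p * x = 0 by linarith)).resolve_right hx.ne'
    have f2 := (mul_eq_zero.1 (show q * y = 0 by linarith)).resolve_right hy.ne'
    have f3 := (mul_eq_zero.1 (show r * z = 0 by linarith)).resolve_right hz.ne'
    linarith
  -- The diagonal from `0` to `(2 + i)/3` splits the hull into two triangles, and `p`, `q`, `r` are
  -- the barycentric coordinates of `t`. The functional vanishes at `t` but is positive at the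
  -- vertices.
  rcases le_total (2 * t.im) t.re with hd | hd
  · exact comb (p := 1 - t.re - t.im) (q := t.re - 2 * t.im) (r := 3 * t.im) (by linarith)
      (by linarith) (by linarith) (by ring) d0 d1 d2 (by ring)
  · exact comb (p := 1 - 3 * t.im) (q := (9 * t.re - 12 * t.im) / 2)
      (r := 9 * (2 * t.im - t.re) / 2) (by linarith)
      (by linarith) (by linarith) (by ring) d0 d2 d3 (by ring)

/-- Composed with `h`, the functional has its unique minimum on the curve at the point sent to the
junction, which is therefore a vertex of the hull. Endpoints are excluded, and `junction 1` and
`tip` give separated pieces. -/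
theorem Crosses.exists_junctionCrosses_of_near {j : Fin 3} {h : ℂ → ℂ} {L : ℂ →ₗ[ℝ] ℂ}
    (hc : Crosses j h) (hmaps : MapsTo h curve curve) (hL : HasLinearPart h L)
    (hinj : Function.Injective h) {α β : ℝ}
    (hpos : ∀ z ∈ curve, h z ≠ junction j →
      0 < α * (h z - junction j).re + β * (h z - junction j).im) :
    ∃ m w, IsWord m w ∧ JunctionCrosses j (h ∘ w) := by
  obtain ⟨t, ht, htj⟩ := hc.exists_eq_junction hmaps hL.continuous le_rfl isPreconnected_curve
    fun z hz _ => hz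
  have hvert := eq_vertex_of_unique_min ht (A := α * (L 1).re + β * (L 1).im)
    (B := α * (L Complex.I).re + β * (L Complex.I).im) fun z hz hzt => by
      have h1 := hpos z hz fun h1 => hzt (hinj (h1.trans htj.symm))
      rw [← htj, hL, linearMap_apply_eq] at h1
      simp at h1
      linarith
  obtain ⟨h0, h1⟩ := hc.ne_endpoint hmaps hL.continuous hinj htj
  rcases hvert with rfl | rfl | rfl | rfl
  · exact absurd rfl h0
  · exact absurd rfl h1
  · exact ⟨0, id, IsWord.nil, hc.junctionCrosses_of_junction hmaps hL.continuous hinj htj⟩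
  · exact hc.junctionCrosses_of_tip hmaps hL.continuous hinj htj

/-- An injective affine map of the curve into itself that crosses a junction maps, after composition
with a word, two consecutive pieces to different sides of this junction. -/
theorem Crosses.exists_junctionCrosses {j : Fin 3} {h : ℂ → ℂ} {L : ℂ →ₗ[ℝ] ℂ}
    (hc : Crosses j h) (hmaps : MapsTo h curve curve) (hL : HasLinearPart h L)
    (hinj : Function.Injective h) : ∃ m w, IsWord m w ∧ JunctionCrosses j (h ∘ w) := by
  obtain ⟨α, β, hnear⟩ := exists_supporting_functional j
  obtain ⟨ε, hε, hball⟩ := Metric.eventually_nhds_iff.1 hnear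
  let C := LinearMap.toContinuousLinearMap L
  have hC : ∀ v, ‖L v‖ ≤ ‖C‖ * ‖v‖ := fun v => C.le_opNorm v
  -- Words of length `n` give copies of diameter at most `2 / 2 ^ n`; this bound makes their images
  -- under `h` smaller than `ε`.
  have hpos : 0 < ε / (2 * (‖C‖ + 1)) := by positivity
  obtain ⟨n, hn⟩ := exists_pow_lt_of_lt_one hpos (show (1 / 2 : ℝ) < 1 by norm_num)
  obtain ⟨m, w, hw, hj | ⟨rfl, hcw⟩⟩ := hc.descend n
  · exact ⟨m, w, hw, hj⟩
  obtain ⟨M, hM⟩ := hw.hasLinearPart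
  have hmaps' : MapsTo (h ∘ w) curve curve := fun z hz => hmaps (hw.mapsTo hz)
  have hL' := hL.comp hM
  have hinj' := hinj.comp hw.injective
  obtain ⟨t, ht, htj⟩ := hcw.exists_eq_junction hmaps' hL'.continuous le_rfl isPreconnected_curve
    fun z hz _ => hz
  obtain ⟨k, v, hv, hjv⟩ := hcw.exists_junctionCrosses_of_near hmaps' hL' hinj' (α := α) (β := β)
    fun z hz hzj => by
      refine hball ?_ (hmaps' hz) hzj
      rw [← htj, dist_eq_norm]
      simp only [Function.comp_apply]
      rw [hL]
      refine (hC _).trans_lt ?_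
      have h1 := hw.dist_le z t
      have h2 := dist_le_of_mem hz ht
      rw [dist_eq_norm] at h1
      have h3 : ‖w z - w t‖ ≤ (1 / 2) ^ m * 2 := h1.trans (by gcongr)
      rw [lt_div_iff₀ (by positivity)] at hn
      have h4 : (0 : ℝ) < (1 / 2) ^ m := by positivity
      nlinarith [norm_nonneg C]
  exact ⟨_, _, hw.append hv, hjv⟩

/-- A degenerate affine map of the curve into itself does not cross a junction, as the curve
contains no segment through a junction. -/
theorem Crosses.injective {j : Fin 3} {h : ℂ → ℂ} {L : ℂ →ₗ[ℝ] ℂ}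
    (hc : Crosses j h) (hmaps : MapsTo h curve curve) (hL : HasLinearPart h L) :
    Function.Injective h := by
  rw [hL.injective_iff]
  intro v hv
  by_contra hv0
  have hn : Complex.normSq v ≠ 0 := fun h => hv0 (Complex.normSq_eq_zero.1 h)
  -- The coordinate along `I * v` in the real basis `v`, `I * v`; since `L` kills `v`, it determines
  -- `L`.
  let φ : ℂ → ℝ := fun z => (z * star v).im / Complex.normSq v
  have hφ : Continuous φ := by
    have : Continuous fun z : ℂ => (z * star v).im :=
      Complex.continuous_im.comp (continuous_id.mul continuous_const)
    exact this.div_const _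
  have hLφ : ∀ z, L z = φ z • L (Complex.I * v) := by
    intro z
    have hz : z = ((z * star v).re / Complex.normSq v) • v + φ z • (Complex.I * v) := by
      have : z * star v * v = Complex.normSq v * z := by
        rw [mul_assoc, mul_comm (star v), Complex.star_def, Complex.mul_conj, mul_comm]
      have h2 : (Complex.normSq v : ℂ) ≠ 0 := by exact_mod_cast hn
      have h3 := Complex.re_add_im (z * star v)
      simp only [φ, Complex.real_smul, Complex.ofReal_div]
      field_simp
      rw [h3, mul_comm z, ← this]
      ring
    conv_lhs => rw [hz]
    rw [map_add, map_smul, hv, smul_zero, zero_add, map_smul]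
  obtain ⟨⟨x, hx, hxl, hxj⟩, y, hy, hyr, hyj⟩ := hc.exists_strict hmaps
  -- The set `φ '' curve` is an interval by connectedness, so the whole segment from `h x` to `h y`
  -- consists of values of `h` on the curve.
  let q : ℝ → ℂ := fun θ => h x + θ • (h y - h x)
  have hq : Continuous q := by fun_prop
  have hqc : ∀ θ ∈ Icc (0 : ℝ) 1, q θ ∈ curve := by
    intro θ hθ
    have hconv : (φ '' curve).OrdConnected :=
      (isPreconnected_curve.image φ hφ.continuousOn).ordConnected
    have hmem : φ x + θ * (φ y - φ x) ∈ φ '' curve := by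
      have := hconv.convex (mem_image_of_mem φ hx) (mem_image_of_mem φ hy)
        (sub_nonneg.2 hθ.2) hθ.1 (by ring)
      simp only [smul_eq_mul] at this
      convert this using 1
      ring
    obtain ⟨z, hz, hzθ⟩ := hmem
    have : q θ = h z := by
      rw [hL.apply z x, hLφ (z - x)]
      simp only [q]
      rw [hL y x, hLφ (y - x)]
      have e : ∀ a b : ℂ, φ (a - b) = φ a - φ b := fun a b => by
        simp only [φ, sub_mul, Complex.sub_im, sub_div]
      rw [e, e, hzθ, smul_smul]
      congr 2
      ring
    exact this ▸ hmaps hz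
  obtain ⟨θ, hθ, hθj⟩ := (isCut_junction j).mem_of_isPreconnected (S := q '' Icc 0 1)
    (image_subset_iff.2 hqc) (isPreconnected_Icc.image q hq.continuousOn)
    (x := h x) (y := h y) ⟨0, by simp, by simp [q]⟩ hxl ⟨1, by simp, by simp [q]⟩ hyr
  have hθ0 : 0 < θ := lt_of_le_of_ne hθ.1 fun h0 => hxj (by rw [← hθj, ← h0]; simp [q])
  have hθ1 : θ < 1 := lt_of_le_of_ne hθ.2 fun h0 => hyj (by rw [← hθj, h0]; simp [q])
  have hxy : h y - h x ≠ 0 := fun h0 => hxj (by rw [← hθj]; simp [q, h0])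
  obtain ⟨α, β, hnear⟩ := exists_supporting_functional j
  rw [← hθj] at hnear
  obtain ⟨ε, hε, hball⟩ := Metric.eventually_nhds_iff.1 (hq.continuousAt.eventually hnear)
  have hsub : ∀ s, q s - q θ = (s - θ) • (h y - h x) := fun s => by
    simp only [q]
    module
  have hsign : ∀ s, dist s θ < ε → s ∈ Icc (0 : ℝ) 1 → s ≠ θ →
      0 < (s - θ) * (α * (h y - h x).re + β * (h y - h x).im) := by
    intro s hs hs01 hsθ
    have := hball hs (hqc s hs01) (fun h0 => smul_ne_zero (sub_ne_zero.2 hsθ) hxy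
      (by rw [← hsub, h0, sub_self]))
    rw [hsub] at this
    simp only [Complex.real_smul, Complex.re_ofReal_mul, Complex.im_ofReal_mul] at this
    linarith
  -- The segment leaves the junction in two opposite directions, and the functional cannot be
  -- positive on both.
  let δ := min (ε / 2) (min θ (1 - θ))
  have hδ : 0 < δ := lt_min (by linarith) (lt_min hθ0 (by linarith))
  have hδ1 : δ ≤ ε / 2 := min_le_left _ _
  have hδ2 : δ ≤ θ := (min_le_right _ _).trans (min_le_left _ _)
  have hδ3 : δ ≤ 1 - θ := (min_le_right _ _).trans (min_le_right _ _)
  have s1 := hsign (θ + δ) (by rw [Real.dist_eq, add_sub_cancel_left, abs_of_pos hδ]; linarith)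
    ⟨by linarith, by linarith⟩ (by linarith)
  have s2 := hsign (θ - δ) (by rw [Real.dist_eq, sub_sub_cancel_left, abs_neg, abs_of_pos hδ]; linarith)
    ⟨by linarith, by linarith⟩ (by linarith)
  linarith

/-! ### Linear parts of maps that cross a junction at a junction -/

/-- An affine map between parts of the curve near a junction respects the boundary rays and the
tips of the corresponding end models. -/
theorem HasLinearPart.map_end {S S' : Set ℂ} {e u e' u' : ℂ} (hS : EndModel S e u)
    (hS' : EndModel S' e' u') (hcpt : IsCompact S) {k : ℂ → ℂ} {L : ℂ →ₗ[ℝ] ℂ}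
    (hL : HasLinearPart k L) (hinj : ∀ v, L v = 0 → v = 0) {p p' μ μ' : ℂ} (hμ : μ ≠ 0)
    (hμ' : μ' ≠ 0) {X Y : Set ℂ} (hp : k p = p')
    (hX : ∀ n : ℕ, ∀ s ∈ S, p + μ * ((3⁻¹ ^ n : ℝ) • s) ∈ X) (hXY : MapsTo k X Y)
    (hY : ∀ᶠ z in 𝓝 p', z ∈ Y → ∃ s ∈ S', z = p' + μ' * s) :
    (∃ α : ℝ, 0 < α ∧ L (μ * e) = α • (μ' * e')) ∧
      ∃ n : ℤ, L (μ * u) = (3 ^ n : ℝ) • (μ' * u') := by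
  obtain ⟨ε, hε, hball⟩ := Metric.eventually_nhds_iff.1 hY
  have hcont : Continuous fun s => L (μ * s) :=
    L.continuous_of_finiteDimensional.comp (continuous_const.mul continuous_id)
  obtain ⟨R, hR⟩ := (hcpt.image hcont).isBounded.exists_norm_le
  have hR' : ∀ s ∈ S, ‖L (μ * s)‖ ≤ R := fun s hs => hR _ ⟨s, hs, rfl⟩
  have hR0 : 0 ≤ R := (norm_nonneg _).trans (hR' 0 hS.zero_mem)
  obtain ⟨n, hn⟩ := exists_pow_lt_of_lt_one (show 0 < ε / (R + 1) by positivity)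
    (show (3 : ℝ)⁻¹ < 1 by norm_num)
  rw [lt_div_iff₀ (by positivity)] at hn
  have hpos : (0 : ℝ) < 3⁻¹ ^ n := by positivity
  -- Scaling by `3⁻¹ ^ n` brings the image close enough to `p'` for `Y` to lie in the target model.
  -- Undoing it afterwards is why the exponent is an integer and not a natural number.
  let N : ℂ →ₗ[ℝ] ℂ := (3⁻¹ ^ n : ℝ) • (LinearMap.mulLeft ℝ μ'⁻¹ ∘ₗ L ∘ₗ LinearMap.mulLeft ℝ μ)
  have hN : ∀ v, N v = (3⁻¹ ^ n : ℝ) • (μ'⁻¹ * L (μ * v)) := fun v => rfl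
  have hmaps : MapsTo N S S' := by
    intro s hs
    have h1 : k (p + μ * ((3⁻¹ ^ n : ℝ) • s)) = p' + (3⁻¹ ^ n : ℝ) • L (μ * s) := by
      rw [hL.apply _ p, hp, add_sub_cancel_left, mul_smul_comm, map_smul]
    have h2 : dist (p' + (3⁻¹ ^ n : ℝ) • L (μ * s)) p' < ε := by
      rw [dist_eq_norm, add_sub_cancel_left, norm_smul, Real.norm_of_nonneg hpos.le]
      nlinarith [hR' s hs]
    obtain ⟨s', hs', h3⟩ := hball h2 (h1 ▸ hXY (hX n s hs))
    have h4 : N s = s' := by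
      rw [hN, ← mul_smul_comm, add_left_cancel h3, inv_mul_cancel_left₀ hμ']
    exact h4 ▸ hs'
  have hNinj : ∀ v, N v = 0 → v = 0 := by
    intro v hv
    rw [hN, smul_eq_zero, mul_eq_zero] at hv
    rcases hv with hv | hv | hv
    · exact absurd hv hpos.ne'
    · exact absurd hv (inv_ne_zero hμ')
    · exact (mul_eq_zero.1 (hinj _ hv)).resolve_left hμ
  have hback : ∀ v, L (μ * v) = (3 ^ n : ℝ) • (μ' * N v) := by
    intro v
    rw [hN, mul_smul_comm, mul_inv_cancel_left₀ hμ', smul_smul, ← mul_pow]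
    norm_num
  obtain ⟨⟨α, hα, he⟩, m, hu⟩ := hS.linear_map hS' hNinj hmaps
  refine ⟨⟨3 ^ n * α, by positivity, ?_⟩, (n : ℤ) - m, ?_⟩
  · rw [hback, he, mul_smul_comm, smul_smul]
  · rw [hback, hu, mul_smul_comm, smul_smul, zpow_sub₀ (by norm_num), zpow_natCast, zpow_natCast,
      inv_pow, div_eq_mul_inv]

theorem isCompact_translate : IsCompact ((fun z : ℂ => z - 1) '' curve) :=
  isCompact_curve.image (by fun_prop)

/-- Iterating `d` inside a piece shrinks it towards its end by powers of `3`; `right_source` uses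
`a` at the start in the same way. -/
theorem left_source (i : Fin 3) (n : ℕ) : ∀ s ∈ (fun z : ℂ => z - 1) '' curve,
    junction i + ratio i.castSucc / 3 * ((3⁻¹ ^ n : ℝ) • s) ∈ piece i.castSucc '' curve := by
  rintro _ ⟨z, hz, rfl⟩
  refine ⟨(piece 3)^[n] z, MapsTo.iterate (fun z hz => piece_mem hz) n hz, ?_⟩
  rw [piece_three_iterate, ← piece_castSucc_one, Complex.real_smul]
  simp only [piece]
  ring

theorem right_source (i : Fin 3) (n : ℕ) : ∀ s ∈ curve,
    junction i + ratio i.succ / 3 * ((3⁻¹ ^ n : ℝ) • s) ∈ piece i.succ '' curve := by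
  intro z hz
  refine ⟨(piece 0)^[n] z, MapsTo.iterate (fun z hz => piece_mem hz) n hz, ?_⟩
  rw [piece_zero_iterate, ← piece_succ_zero, Complex.real_smul]
  simp only [piece]
  ring

theorem left_target (j : Fin 3) : ∀ᶠ z in 𝓝 (junction j), z ∈ leftPart j →
    ∃ s ∈ (fun z : ℂ => z - 1) '' curve, z = junction j + ratio j.castSucc / 3 * s := by
  filter_upwards [eventually_mem_piece_of_leftPart j] with z hz hzl
  obtain ⟨w, hw, rfl⟩ := hz hzl
  refine ⟨_, ⟨w, hw, rfl⟩, ?_⟩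
  rw [← piece_castSucc_one]
  simp only [piece]
  ring

theorem right_target (j : Fin 3) : ∀ᶠ z in 𝓝 (junction j), z ∈ rightPart j →
    ∃ s ∈ curve, z = junction j + ratio j.succ / 3 * s := by
  filter_upwards [eventually_mem_piece_of_rightPart j] with z hz hzl
  obtain ⟨w, hw, rfl⟩ := hz hzl
  refine ⟨w, hw, ?_⟩
  rw [← piece_succ_zero]
  simp only [piece]
  ring

/-- Relations between the two tip factors that an exchange of sides would force where positivity
gives no contradiction (`not_rays_swapped`). In each, `7` or `2` divides only the right-hand side.
-/
theorem three_zpow_ne (m n : ℤ) : 3 * (3 : ℝ) ^ m ≠ 7 * 3 ^ n ∧ 12 * (3 : ℝ) ^ m ≠ 7 * 3 ^ n ∧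
    3 * (3 : ℝ) ^ m ≠ 4 * 3 ^ n := by
  have key : ∀ p q : ℕ, (∀ a b : ℕ, p * 3 ^ a ≠ q * 3 ^ b) → (p : ℝ) * 3 ^ m ≠ q * 3 ^ n := by
    intro p q h heq
    rcases le_total m n with hmn | hmn
    · obtain ⟨a, ha⟩ := Int.eq_ofNat_of_zero_le (sub_nonneg.2 hmn)
      rw [show n = m + a by omega, zpow_add₀ (by norm_num), zpow_natCast] at heq
      have h3 : (3 : ℝ) ^ m ≠ 0 := by positivity
      have : (p : ℝ) = q * 3 ^ a := mul_left_cancel₀ h3 (by linarith)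
      exact h 0 a (by rw [pow_zero, mul_one]; exact_mod_cast this)
    · obtain ⟨a, ha⟩ := Int.eq_ofNat_of_zero_le (sub_nonneg.2 hmn)
      rw [show m = n + a by omega, zpow_add₀ (by norm_num), zpow_natCast] at heq
      have h3 : (3 : ℝ) ^ n ≠ 0 := by positivity
      have : (p : ℝ) * 3 ^ a = q := mul_left_cancel₀ h3 (by linarith)
      exact h a 0 (by rw [pow_zero, mul_one]; exact_mod_cast this)
  have h7 : ∀ p a b : ℕ, ¬ 7 ∣ p → p * 3 ^ a ≠ 7 * 3 ^ b := by
    intro p a b hp h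
    have h1 : 7 ∣ p * 3 ^ a := h ▸ Dvd.dvd.mul_right (by norm_num) _
    rcases (Nat.Prime.dvd_mul (by norm_num)).1 h1 with h2 | h2
    · exact hp h2
    · exact absurd (Nat.Prime.dvd_of_dvd_pow (by norm_num) h2) (by norm_num)
  refine ⟨fun h => key 3 7 (fun a b => h7 3 a b (by norm_num)) (by push_cast; linarith),
    fun h => key 12 7 (fun a b => h7 12 a b (by norm_num)) (by push_cast; linarith),
    fun h => key 3 4 (fun a b hab => ?_) (by push_cast; linarith)⟩
  have h1 : 2 ∣ 3 ^ (a + 1) := by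
    rw [pow_succ', hab]
    exact Dvd.dvd.mul_right (by norm_num) _
  exact absurd (Nat.Prime.dvd_of_dvd_pow (by norm_num) h1) (by norm_num)

theorem linearMap_apply_re (L : ℂ →ₗ[ℝ] ℂ) (z : ℂ) :
    (L z).re = z.re * (L 1).re + z.im * (L Complex.I).re := by
  rw [linearMap_apply_eq]; simp

theorem linearMap_apply_im (L : ℂ →ₗ[ℝ] ℂ) (z : ℂ) :
    (L z).im = z.re * (L 1).im + z.im * (L Complex.I).im := by
  rw [linearMap_apply_eq]; simp

set_option maxHeartbeats 1000000 in
/-- A linear map that takes the four boundary rays at a junction to the corresponding rays at a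
junction is scalar. -/
theorem eq_scalar_of_rays {i j : Fin 3} {L : ℂ →ₗ[ℝ] ℂ} {α β γ δ : ℝ} (hα : 0 < α) (hβ : 0 < β)
    (hγ : 0 < γ) (hδ : 0 < δ)
    (h₁ : L (ratio i.castSucc / 3 * -1) = α • (ratio j.castSucc / 3 * -1))
    (h₂ : L (ratio i.castSucc / 3 * (junction 1 - 1)) =
      β • (ratio j.castSucc / 3 * (junction 1 - 1)))
    (h₃ : L (ratio i.succ / 3 * 1) = γ • (ratio j.succ / 3 * 1))
    (h₄ : L (ratio i.succ / 3 * tip) = δ • (ratio j.succ / 3 * tip)) :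
    i = j ∧ ∀ z, L z = β • z := by
  have r1 := congrArg Complex.re h₁
  have i1 := congrArg Complex.im h₁
  have r2 := congrArg Complex.re h₂
  have i2 := congrArg Complex.im h₂
  have r3 := congrArg Complex.re h₃
  have i3 := congrArg Complex.im h₃
  have r4 := congrArg Complex.re h₄
  have i4 := congrArg Complex.im h₄
  rw [linearMap_apply_re] at r1 r2 r3 r4
  rw [linearMap_apply_im] at i1 i2 i3 i4
  have hscalar : (L 1).re = β → (L 1).im = 0 → (L Complex.I).re = 0 → (L Complex.I).im = β →
      ∀ z, L z = β • z := fun h1 h2 h3 h4 z => by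
    apply Complex.ext
    · rw [linearMap_apply_re, h1, h3]; simp [mul_comm]
    · rw [linearMap_apply_im, h2, h4]; simp [mul_comm]
  fin_cases i <;> fin_cases j <;>
    simp [ratio, tip_re, tip_im, junction_one_re, junction_one_im] at r1 i1 r2 i2 r3 i3 r4 i4 <;>
    first
    | (exfalso; linarith)
    | exact ⟨rfl, hscalar (by linarith) (by linarith) (by linarith) (by linarith)⟩

/-- No linear map exchanges the two sides of a junction (or of two junctions). -/
theorem not_rays_swapped {i j : Fin 3} {L : ℂ →ₗ[ℝ] ℂ} {α γ : ℝ} {m n : ℤ} (hα : 0 < α)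
    (hγ : 0 < γ) (h₁ : L (ratio i.castSucc / 3 * -1) = α • (ratio j.succ / 3 * 1))
    (h₂ : L (ratio i.castSucc / 3 * (junction 1 - 1)) = (3 ^ m : ℝ) • (ratio j.succ / 3 * tip))
    (h₃ : L (ratio i.succ / 3 * 1) = γ • (ratio j.castSucc / 3 * -1))
    (h₄ : L (ratio i.succ / 3 * tip) = (3 ^ n : ℝ) • (ratio j.castSucc / 3 * (junction 1 - 1))) :
    False := by
  have hβ : (0 : ℝ) < 3 ^ m := by positivity
  have hδ : (0 : ℝ) < 3 ^ n := by positivity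
  obtain ⟨t1, t2, t3⟩ := three_zpow_ne n m
  generalize (3 : ℝ) ^ m = β at *
  generalize (3 : ℝ) ^ n = δ at *
  have r1 := congrArg Complex.re h₁
  have i1 := congrArg Complex.im h₁
  have r2 := congrArg Complex.re h₂
  have i2 := congrArg Complex.im h₂
  have r3 := congrArg Complex.re h₃
  have i3 := congrArg Complex.im h₃
  have r4 := congrArg Complex.re h₄
  have i4 := congrArg Complex.im h₄
  rw [linearMap_apply_re] at r1 r2 r3 r4
  rw [linearMap_apply_im] at i1 i2 i3 i4
  fin_cases i <;> fin_cases j <;>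
    simp [ratio, tip_re, tip_im, junction_one_re, junction_one_im] at r1 i1 r2 i2 r3 i3 r4 i4 <;>
    first
    | linarith
    | exact t1 (by linarith)
    | exact t2 (by linarith)
    | exact t3 (by linarith)

/-! ### Rigidity -/

/-- The pieces `b` and `c` arch over the middle third of the base and meet the real axis only in
`1/3` and `2/3`. -/
theorem not_mem_gap {z : ℂ} (hz : z ∈ curve) (him : z.im = 0) :
    ¬ (1 / 3 < z.re ∧ z.re < 2 / 3) := by
  obtain ⟨i, w, hw, rfl⟩ := mem_curve_iff.1 hz
  obtain ⟨h1, h2, h3, h4⟩ := curve_bounds hw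
  rintro ⟨g1, g2⟩
  fin_cases i <;> simp at him g1 g2 <;> linarith

/-- On this line the first three pieces have only the point `(2 + i)/3`, and the last one starts at
real part `8/9`. The bound `7/9` is what a homothety at `(2 + i)/3` of factor at most `1/3` reaches
from `1`. -/
theorem not_mem_antidiagonal_gap {z : ℂ} (hz : z ∈ curve) (h : z.re + z.im = 1) :
    ¬ (2 / 3 < z.re ∧ z.re ≤ 7 / 9) := by
  obtain ⟨i, w, hw, rfl⟩ := mem_curve_iff.1 hz
  obtain ⟨h1, h2, h3, h4⟩ := curve_bounds hw
  rintro ⟨g1, g2⟩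
  fin_cases i <;> simp at h g1 g2 <;> linarith

/-- A homothety centred at a junction, with factor a power of `3`, that maps the curve into itself
is trivial. -/
theorem homothety_factor_eq_one {i : Fin 3} {k : ℂ → ℂ} {L : ℂ →ₗ[ℝ] ℂ} {n : ℤ}
    (hL : HasLinearPart k L) (hLn : ∀ z, L z = (3 ^ n : ℝ) • z) (hk : k (junction i) = junction i)
    (hmaps : MapsTo k curve curve) : (3 : ℝ) ^ n = 1 := by
  have hpos : (0 : ℝ) < 3 ^ n := by positivity
  have hk' : ∀ z, k z = junction i + (3 ^ n : ℝ) • (z - junction i) := fun z => by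
    rw [hL.apply z (junction i), hk, hLn]
  have h0 := hmaps zero_mem_curve
  have h1 := hmaps one_mem_curve
  rcases lt_trichotomy n 0 with hn | rfl | hn
  · exfalso
    have hle : (3 : ℝ) ^ n ≤ 1 / 3 := by
      have : (3 : ℝ) ^ n ≤ 3 ^ (-1 : ℤ) := zpow_le_zpow_right₀ (by norm_num) (by omega)
      simpa using this
    rw [hk'] at h0 h1
    generalize (3 : ℝ) ^ n = r at *
    -- The image of `1`, or of `0` for the last junction, falls into a gap.
    fin_cases i
    · refine not_mem_gap h1 ?_ ⟨?_, ?_⟩ <;> simp [junction_zero_re, junction_zero_im] <;> linarith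
    · refine not_mem_antidiagonal_gap h1 ?_ ⟨?_, ?_⟩ <;>
        simp [junction_one_re, junction_one_im] <;> linarith
    · refine not_mem_gap h0 ?_ ⟨?_, ?_⟩ <;> simp [junction_two_re, junction_two_im] <;> linarith
  · simp
  · exfalso
    have hlt : (1 : ℝ) < 3 ^ n := one_lt_zpow₀ (by norm_num) hn
    have h2 := congrArg Complex.re (hL 1 0)
    rw [hLn] at h2
    simp only [sub_zero, Complex.sub_re, Complex.real_smul, mul_one, Complex.ofReal_re] at h2
    obtain ⟨a1, a2, a3, a4⟩ := curve_bounds h0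
    obtain ⟨b1, b2, b3, b4⟩ := curve_bounds h1
    linarith

/-- An injective affine map of the curve into itself that maps consecutive pieces to different sides
of a junction is the identity. -/
theorem JunctionCrosses.eq_id {j : Fin 3} {k : ℂ → ℂ} {L : ℂ →ₗ[ℝ] ℂ} (hj : JunctionCrosses j k)
    (hmaps : MapsTo k curve curve) (hL : HasLinearPart k L) (hinj : Function.Injective k) :
    k = id := by
  have hinj' := hL.injective_iff.1 hinj
  have hne : ∀ l, ratio l / 3 ≠ 0 := fun l => div_ne_zero (ratio_ne_zero l) (by norm_num)
  obtain ⟨i, ⟨hl, hr⟩ | ⟨hl, hr⟩⟩ := hj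
  · have hp : k (junction i) = junction j := by
      refine (isCut_junction j).inter _ ?_ (hr zero_mem_curve)
      have := hl one_mem_curve
      rwa [Function.comp_apply, piece_castSucc_one] at this
    obtain ⟨⟨α, hα, h₁⟩, m, h₂⟩ := hL.map_end endModel_one endModel_one isCompact_translate hinj'
      (hne _) (hne _) hp (left_source i) (mapsTo_image_iff.2 hl) (left_target j)
    obtain ⟨⟨γ, hγ, h₃⟩, n, h₄⟩ := hL.map_end endModel_zero endModel_zero isCompact_curve hinj'
      (hne _) (hne _) hp (right_source i) (mapsTo_image_iff.2 hr) (right_target j)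
    obtain ⟨rfl, hscalar⟩ := eq_scalar_of_rays hα (by positivity) hγ (by positivity) h₁ h₂ h₃ h₄
    have h1 := homothety_factor_eq_one hL hscalar hp hmaps
    funext z
    rw [hL.apply z (junction i), hp, hscalar, h1, one_smul, add_sub_cancel, id]
  · exfalso
    have hp : k (junction i) = junction j := by
      refine (isCut_junction j).inter _ (hr zero_mem_curve) ?_
      have := hl one_mem_curve
      rwa [Function.comp_apply, piece_castSucc_one] at this
    obtain ⟨⟨α, hα, h₁⟩, m, h₂⟩ := hL.map_end endModel_one endModel_zero isCompact_translate hinj'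
      (hne _) (hne _) hp (left_source i) (mapsTo_image_iff.2 hl) (right_target j)
    obtain ⟨⟨γ, hγ, h₃⟩, n, h₄⟩ := hL.map_end endModel_zero endModel_one isCompact_curve hinj'
      (hne _) (hne _) hp (right_source i) (mapsTo_image_iff.2 hr) (left_target j)
    exact not_rays_swapped hα hγ h₁ h₂ h₃ h₄

/-- Only the first piece contains `0`, and only the last contains `1`. -/
theorem not_curve_subset_piece (i : Fin 4) : ¬ curve ⊆ piece i '' curve := by
  intro h
  obtain ⟨w, hw, hw0⟩ := h zero_mem_curve
  obtain ⟨v, hv, hv1⟩ := h one_mem_curve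
  rcases (Fin.zero_le i).eq_or_lt with rfl | hi
  · exact one_ne_zero (piece_eq_piece (l := 0) (k := 3) (by decide) hv one_mem_curve
      (hv1.trans piece_three_one.symm)).2.2
  · exact zero_ne_one (piece_eq_piece hi zero_mem_curve hw (piece_zero_zero.trans hw0.symm)).2.1

/-- An affine map of the curve into itself that crosses a junction is the identity. -/
theorem Crosses.eq_id {j : Fin 3} {h : ℂ → ℂ} {L : ℂ →ₗ[ℝ] ℂ} (hc : Crosses j h)
    (hmaps : MapsTo h curve curve) (hL : HasLinearPart h L) : h = id := by
  have hinj := hc.injective hmaps hL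
  obtain ⟨m, w, hw, hj⟩ := hc.exists_junctionCrosses hmaps hL hinj
  obtain ⟨M, hM⟩ := hw.hasLinearPart
  have hid : h ∘ w = id := hj.eq_id (fun z hz => hmaps (hw.mapsTo hz)) (hL.comp hM)
    (hinj.comp hw.injective)
  cases hw with
  | nil => exact hid
  | cons i hw =>
    rename_i n v
    refine absurd (fun z hz => ?_) (not_curve_subset_piece i)
    -- By injectivity of `h`, its right inverse is also a left inverse, so the first letter of a
    -- nonempty word would cover the curve.
    have h1 : piece i (v (h z)) = z := hinj (congrFun hid (h z))
    exact ⟨v (h z), hw.mapsTo (hmaps hz), h1⟩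

theorem mem_piece_of_mem_parts {j j' : Fin 3} (hjj : j.succ = j'.castSucc) {z : ℂ}
    (hzr : z ∈ rightPart j) (hzl : z ∈ leftPart j') : z ∈ piece j.succ '' curve := by
  obtain ⟨l, hl, w, hw, rfl⟩ := mem_rightPart.1 hzr
  obtain ⟨k, hk, v, hv, hvw⟩ := mem_leftPart.1 hzl
  rw [← hjj] at hk
  rcases hl.eq_or_lt with rfl | hl
  · exact ⟨w, hw, rfl⟩
  rcases hk.eq_or_lt with rfl | hk
  · exact ⟨v, hv, hvw⟩
  have h1 := (piece_eq_piece (hk.trans hl) hv hw hvw).1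
  have h2 : (k : ℕ) < j.succ := hk
  have h3 : (j.succ : ℕ) < l := hl
  omega

theorem mapsTo_side_of_not_crosses {j : Fin 3} {f : ℂ → ℂ} (h : ¬ Crosses j f) :
    MapsTo f curve (leftPart j) ∨ MapsTo f curve (rightPart j) := by
  by_contra hcon
  exact h (not_or.1 hcon)

/-- The image is on one side of each junction; the first junction that it precedes singles out the
piece, and there is none exactly when it is the last piece. -/
theorem exists_mapsTo_piece {f : ℂ → ℂ} (h : ∀ j, ¬ Crosses j f) :
    ∃ i, MapsTo f curve (piece i '' curve) := by
  rcases mapsTo_side_of_not_crosses (h 0) with h0 | h0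
  · refine ⟨0, fun z hz => ?_⟩
    obtain ⟨l, hl, w, hw, hwz⟩ := mem_leftPart.1 (h0 hz)
    obtain rfl : l = 0 := Fin.le_zero_iff.1 hl
    exact ⟨w, hw, hwz⟩
  rcases mapsTo_side_of_not_crosses (h 1) with h1 | h1
  · exact ⟨_, fun z hz => mem_piece_of_mem_parts (j := 0) (j' := 1) rfl (h0 hz) (h1 hz)⟩
  rcases mapsTo_side_of_not_crosses (h 2) with h2 | h2
  · exact ⟨_, fun z hz => mem_piece_of_mem_parts (j := 1) (j' := 2) rfl (h1 hz) (h2 hz)⟩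
  · refine ⟨3, fun z hz => ?_⟩
    obtain ⟨l, hl, w, hw, hwz⟩ := mem_rightPart.1 (h2 hz)
    obtain rfl : l = 3 := le_antisymm (Fin.le_last l) hl
    exact ⟨w, hw, hwz⟩

theorem exists_piece_comp_eq (i : Fin 4) (f : ℂ → ℂ) : ∃ g : ℂ → ℂ, ∀ z, piece i (g z) = f z := by
  refine ⟨fun z => (f z - shift i) / (ratio i / 3), fun z => ?_⟩
  rw [piece, mul_div_cancel₀ _ (div_ne_zero (ratio_ne_zero i) (by norm_num)), sub_add_cancel]

/-- Every affine map of the curve into itself that is not constant on the curve is the identity or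
the composition of a word. -/
theorem exists_isWord {f : ℂ → ℂ} {L : ℂ →ₗ[ℝ] ℂ} (hmaps : MapsTo f curve curve)
    (hL : HasLinearPart f L) {x y : ℂ} (hx : x ∈ curve) (hy : y ∈ curve) (hxy : f x ≠ f y) :
    ∃ n, IsWord n f := by
  -- Here `n` bounds how often a letter can be stripped: this at least doubles the distance between
  -- the values at `x` and `y`, which never exceeds `2`.
  have key : ∀ (n : ℕ) (f : ℂ → ℂ) (L : ℂ →ₗ[ℝ] ℂ), MapsTo f curve curve → HasLinearPart f L →
      2 < 2 ^ n * dist (f x) (f y) → ∃ n, IsWord n f := by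
    intro n
    induction n with
    | zero =>
      intro f L hmaps hL hn
      have := dist_le_of_mem (hmaps hx) (hmaps hy)
      linarith
    | succ n ih =>
      intro f L hmaps hL hn
      by_cases hc : ∃ j, Crosses j f
      · obtain ⟨j, hj⟩ := hc
        exact ⟨0, hj.eq_id hmaps hL ▸ IsWord.nil⟩
      · obtain ⟨i, hi⟩ := exists_mapsTo_piece (not_exists.1 hc)
        obtain ⟨g, hg⟩ := exists_piece_comp_eq i f
        have hgmaps : MapsTo g curve curve := by
          intro z hz
          obtain ⟨w, hw, hwz⟩ := hi hz
          rw [← hg] at hwz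
          exact piece_injective i hwz ▸ hw
        have hd := dist_piece_le i (g x) (g y)
        rw [hg, hg] at hd
        obtain ⟨m, hm⟩ := ih g _ hgmaps (hL.of_piece_comp hg) (by
          rw [pow_succ] at hn
          have : (0 : ℝ) < 2 ^ n := by positivity
          nlinarith)
        exact ⟨m + 1, (funext hg : piece i ∘ g = f) ▸ hm.cons i⟩
  have hpos : 0 < dist (f x) (f y) / 2 := half_pos (dist_pos.2 hxy)
  obtain ⟨n, hn⟩ := exists_pow_lt_of_lt_one hpos (show (1 / 2 : ℝ) < 1 by norm_num)
  refine key n f L hmaps hL ?_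
  rw [one_div, inv_pow, inv_lt_iff_one_lt_mul₀ (by positivity)] at hn
  linarith

theorem IsWord.mem_semigroup {n : ℕ} {w : ℂ → ℂ} (hw : IsWord n w) (hn : n ≠ 0) :
    w ∈ ifs.semigroup := by
  induction hw with
  | nil => exact absurd rfl hn
  | cons i hw ih =>
    rename_i n w
    have hi : piece i ∈ ifs.semigroup := Subsemigroup.subset_closure (piece_mem_maps i)
    rcases eq_or_ne n 0 with rfl | hn
    · cases hw
      exact hi
    · exact ifs.semigroup.mul_mem hi (ih hn)

theorem mem_semigroup_iff {f : ℂ → ℂ} : f ∈ ifs.semigroup ↔ ∃ n, n ≠ 0 ∧ IsWord n f := by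
  constructor
  · intro hf
    refine Subsemigroup.closure_induction (M := Function.End ℂ)
      (p := fun f _ => ∃ n, n ≠ 0 ∧ IsWord n f) ?_ ?_ hf
    · intro f hf
      obtain ⟨i, rfl⟩ := mem_maps_iff.1 hf
      exact ⟨1, one_ne_zero, isWord_piece i⟩
    · rintro f g - - ⟨n, hn, hf⟩ ⟨m, hm, hg⟩
      exact ⟨n + m, by omega, hf.append hg⟩
  · rintro ⟨n, hn, hf⟩
    exact hf.mem_semigroup hn

theorem not_isContractionOf_id : ¬ IsContractionOf curve id := by
  rintro ⟨-, K, hK, hlip⟩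
  have h1 := hlip.dist_le_mul 0 zero_mem_curve 1 one_mem_curve
  have h2 : (K : ℝ) < 1 := hK
  simp at h1
  linarith

theorem mem_semigroup_iff_isContractionOf (f : ℂ → ℂ) :
    (IsRealAffine f ∧ IsContractionOf curve f ∧ (f '' curve).Nontrivial) ↔
      f ∈ ifs.semigroup := by
  rw [mem_semigroup_iff]
  constructor
  · rintro ⟨haff, hcon, hnt⟩
    obtain ⟨L, hL⟩ := isRealAffine_iff.1 haff
    obtain ⟨_, ⟨x, hx, rfl⟩, _, ⟨y, hy, rfl⟩, hxy⟩ := hnt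
    obtain ⟨n, hn⟩ := exists_isWord hcon.1 hL hx hy hxy
    refine ⟨n, ?_, hn⟩
    rintro rfl
    cases hn
    exact not_isContractionOf_id hcon
  · rintro ⟨n, hn, hw⟩
    refine ⟨isRealAffine_iff.2 hw.hasLinearPart, ⟨hw.mapsTo, (1 / 2) ^ n, ?_, ?_⟩, ?_⟩
    · exact pow_lt_one₀ zero_le one_half_lt_one hn
    · refine LipschitzOnWith.of_dist_le_mul fun x _ y _ => ?_
      simpa using hw.dist_le x y
    · exact ⟨_, ⟨0, zero_mem_curve, rfl⟩, _, ⟨1, one_mem_curve, rfl⟩,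
        fun h => zero_ne_one (hw.injective h)⟩

/-! ### Ends of affine systems with the same attractor -/

theorem mapsTo_of_attractor_eq {F : IFS ℂ} (hA : F.attractor = curve) {f : Function.End ℂ}
    (hf : f ∈ F.maps) : MapsTo f curve curve := by
  intro z hz
  rw [← hA] at hz ⊢
  rw [← F.isAttractor_attractor.iUnion_image_eq]
  exact mem_biUnion hf ⟨z, hz, rfl⟩

/-- The maps in the semigroup of an affine system are contracting affine maps of the curve. -/
theorem semigroup_properties {F : IFS ℂ} (haff : ∀ f ∈ F.maps, IsRealAffine f)
    (hA : F.attractor = curve) {s : Function.End ℂ} (hs : s ∈ F.semigroup) :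
    (∃ L, HasLinearPart s L) ∧ MapsTo s curve curve ∧ ∃ K : NNReal, K < 1 ∧ LipschitzWith K s := by
  refine Subsemigroup.closure_induction (M := Function.End ℂ)
    (p := fun s _ => (∃ L, HasLinearPart s L) ∧ MapsTo s curve curve ∧ ∃ K : NNReal, K < 1 ∧ LipschitzWith K s) ?_ ?_ hs
  · intro f hf
    obtain ⟨K, hK⟩ := F.contracting f hf
    exact ⟨isRealAffine_iff.1 (haff f hf), mapsTo_of_attractor_eq hA hf, K, hK⟩
  · rintro f g - - ⟨⟨L, hL⟩, hf, K, hK, hKf⟩ ⟨⟨M, hM⟩, hg, K', hK', hKg⟩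
    exact ⟨⟨_, hL.comp hM⟩, hf.comp hg, K * K', mul_lt_one' hK hK', hKf.comp hKg⟩

/-- By rigidity a crossing map would be the identity, which is not contracting. -/
theorem mapsTo_side {F : IFS ℂ} (haff : ∀ f ∈ F.maps, IsRealAffine f)
    (hA : F.attractor = curve) {s : Function.End ℂ} (hs : s ∈ F.semigroup) :
    MapsTo s curve (leftPart 0) ∨ MapsTo s curve (rightPart 0) := by
  obtain ⟨⟨L, hL⟩, hmaps, K, hK, hlip⟩ := semigroup_properties haff hA hs
  refine mapsTo_side_of_not_crosses fun hc => not_isContractionOf_id ?_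
  rw [← hc.eq_id hmaps hL]
  exact ⟨hmaps, K, hK, hlip.lipschitzOnWith⟩

/-- An affine map is determined by its values on the curve. -/
theorem eq_const_of_curve {f : ℂ → ℂ} {L : ℂ →ₗ[ℝ] ℂ} (hL : HasLinearPart f L) {p : ℂ}
    (h : ∀ z ∈ curve, f z = p) (z : ℂ) : f z = p := by
  have h0 := h 0 zero_mem_curve
  have h1 : L 1 = 0 := by
    have := hL 1 0
    rwa [h 1 one_mem_curve, h0, sub_self, sub_zero, eq_comm] at this
  have h2 : L (junction 1) = 0 := by
    have := hL (junction 1) 0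
    rwa [h _ (junction_mem 1), h0, sub_self, sub_zero, eq_comm] at this
  rw [linearMap_apply_eq, h1, smul_zero, zero_add, junction_one_im] at h2
  have h3 : L Complex.I = 0 := (smul_eq_zero.1 h2).resolve_left (by norm_num)
  rw [hL.apply z 0, h0, linearMap_apply_eq, h1, h3, smul_zero, smul_zero, add_zero, add_zero]

/-- The vertices that collapse the curve to the junction `1/3`. -/
def cutVertices (F : IFS ℂ) : Set F.semigroup :=
  {s | ∀ z, (s : Function.End ℂ) z = junction 0}

theorem finite_cutVertices (F : IFS ℂ) : (cutVertices F).Finite := by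
  refine Set.Subsingleton.finite fun s hs t ht => Subtype.ext (funext fun z => ?_)
  exact (hs z).trans (ht z).symm

/-- The image of `t` lies in that of `s`. If the sides differed, `t` would map the curve into the
intersection of both sides, so it would be constant at the junction. -/
theorem mapsTo_side_iff_of_edge {F : IFS ℂ} (haff : ∀ f ∈ F.maps, IsRealAffine f)
    (hA : F.attractor = curve) {s t : F.semigroup} (ht : t ∉ cutVertices F) (h : F.Edge s t) :
    MapsTo (s : Function.End ℂ) curve (leftPart 0) ↔
      MapsTo (t : Function.End ℂ) curve (leftPart 0) := by
  obtain ⟨f, hf, hst⟩ := h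
  have hfm := mapsTo_of_attractor_eq hA hf
  have hst' : ∀ z, (t : Function.End ℂ) z = (s : Function.End ℂ) (f z) := fun z => by rw [hst]; rfl
  refine ⟨fun hs z hz => hst' z ▸ hs (hfm hz), fun htl => ?_⟩
  refine (mapsTo_side haff hA s.2).resolve_right fun hs => ht ?_
  obtain ⟨L, hL⟩ := (semigroup_properties haff hA t.2).1
  refine eq_const_of_curve hL fun z hz => (isCut_junction 0).inter _ (htl hz) ?_
  exact hst' z ▸ hs (hfm hz)

theorem mapsTo_side_iff_of_mem {F : IFS ℂ} (haff : ∀ f ∈ F.maps, IsRealAffine f)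
    (hA : F.attractor = curve) {C : F.cayleyGraph.ComponentCompl (cutVertices F)}
    {s t : F.semigroup} (hs : s ∈ C) (ht : t ∈ C) :
    MapsTo (s : Function.End ℂ) curve (leftPart 0) ↔
      MapsTo (t : Function.End ℂ) curve (leftPart 0) := by
  obtain ⟨hs', rfl⟩ := hs
  obtain ⟨ht', hst⟩ := ht
  obtain ⟨w⟩ := SimpleGraph.ConnectedComponent.exact hst
  have key : ∀ x y : ((cutVertices F)ᶜ : Set F.semigroup),
      (F.cayleyGraph.induce (cutVertices F)ᶜ).Walk x y →
      (MapsTo (x.1 : Function.End ℂ) curve (leftPart 0) ↔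
        MapsTo (y.1 : Function.End ℂ) curve (leftPart 0)) := by
    intro x y w
    induction w with
    | nil => rfl
    | cons hadj _ ih =>
      rename_i x y _ _
      refine Iff.trans ?_ ih
      have hadj' : F.cayleyGraph.Adj x.1 y.1 := hadj
      rw [IFS.cayleyGraph, SimpleGraph.fromRel_adj] at hadj'
      rcases hadj'.2 with h | h
      · exact mapsTo_side_iff_of_edge haff hA y.2 h
      · exact (mapsTo_side_iff_of_edge haff hA x.2 h).symm
  exact (key _ _ w).symm

theorem pow_mem_semigroup {F : IFS ℂ} {f : Function.End ℂ} (hf : f ∈ F.maps) (n : ℕ) :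
    f ^ (n + 1) ∈ F.semigroup := by
  induction n with
  | zero =>
    rw [zero_add, pow_one]
    exact Subsemigroup.subset_closure hf
  | succ n ih =>
    rw [pow_succ]
    exact F.semigroup.mul_mem ih (Subsemigroup.subset_closure hf)

/-- The ray of the powers of an injective map. -/
def powRay (F : IFS ℂ) (f : Function.End ℂ) (hf : f ∈ F.maps) (hinj : Function.Injective f) :
    F.Ray where
  vertex n := ⟨f ^ (n + 1), pow_mem_semigroup hf n⟩
  edge n := ⟨f, hf, pow_succ f (n + 1)⟩
  injective := by
    obtain ⟨K, hK, hlip⟩ := F.contracting f hf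
    have hpow : ∀ n z, (f ^ n : Function.End ℂ) z = f^[n] z := fun n z => by
      induction n with
      | zero => rfl
      | succ n ih =>
        have h : (f ^ (n + 1) : Function.End ℂ) z = f ((f ^ n : Function.End ℂ) z) :=
          congrFun (pow_succ' f n) z
        exact (h.trans (congrArg f ih)).trans (Function.iterate_succ_apply' f n z).symm
    -- The powers are told apart by the distance between the images of `0` and `1`, which strictly
    -- decreases.
    have hanti : StrictAnti fun n => dist (f^[n + 1] 0) (f^[n + 1] 1) := by
      refine strictAnti_nat_of_succ_lt fun n => ?_
      have hpos : 0 < dist (f^[n + 1] 0) (f^[n + 1] 1) :=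
        dist_pos.2 fun h => zero_ne_one (hinj.iterate (n + 1) h)
      rw [Function.iterate_succ_apply' f (n + 1), Function.iterate_succ_apply' f (n + 1)]
      have h1 := hlip.dist_le_mul (f^[n + 1] 0) (f^[n + 1] 1)
      have h2 : (K : ℝ) < 1 := hK
      nlinarith
    intro n m h
    have h' : f ^ (n + 1) = f ^ (m + 1) := congrArg Subtype.val h
    refine hanti.injective ?_
    simp only [← hpow, h']

/-- Constant maps in `F` cover only finitely many points of `T`, so a nonconstant one takes a value
in `T` other than the junction. By rigidity it is a word, hence injective, and its powers form a
ray. -/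
theorem exists_ray {F : IFS ℂ} (haff : ∀ f ∈ F.maps, IsRealAffine f)
    (hA : F.attractor = curve) {T : Set ℂ} (hT : T ⊆ curve) (hinf : T.Infinite) :
    ∃ r : F.Ray, ∃ z ∈ curve, ∃ f : Function.End ℂ, f z ∈ T ∧ f z ≠ junction 0 ∧
      ∀ n, (r.vertex n : Function.End ℂ) = f ^ (n + 1) := by
  have hfin : ((fun f : Function.End ℂ => f 0) '' F.maps ∪ {junction 0}).Finite :=
    (F.finite.image _).union (finite_singleton _)
  obtain ⟨y, hy, hy'⟩ := (hinf.sdiff hfin).nonempty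
  rw [mem_union, not_or] at hy'
  have hyA : y ∈ F.attractor := hA ▸ hT hy
  rw [← F.isAttractor_attractor.iUnion_image_eq, hA] at hyA
  obtain ⟨f, hf, z, hz, rfl⟩ := mem_iUnion₂.1 hyA
  have hne : f z ≠ f 0 := fun h => hy'.1 ⟨f, hf, h.symm⟩
  obtain ⟨⟨L, hL⟩, hmaps, -⟩ := semigroup_properties haff hA (Subsemigroup.subset_closure hf)
  obtain ⟨n, hn⟩ := exists_isWord hmaps hL hz zero_mem_curve hne
  exact ⟨powRay F f hf hn.injective, z, hz, f, hy, hy'.2, fun n => rfl⟩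

theorem not_oneEnded_of_attractor_eq {F : IFS ℂ} (haff : ∀ f ∈ F.maps, IsRealAffine f)
    (hA : F.attractor = curve) : ¬ F.OneEnded := by
  intro hone
  have hcut := isCut_junction 0
  have hinf : curve.Infinite := isPreconnected_curve.infinite_of_nontrivial
    ⟨0, zero_mem_curve, 1, one_mem_curve, zero_ne_one⟩
  have hpiece : ∀ i, (piece i '' curve).Infinite := fun i =>
    hinf.image (piece_injective i).injOn
  have hsub : ∀ {f g : Function.End ℂ} {T : Set ℂ}, MapsTo f curve T → MapsTo g curve curve →
      MapsTo (f * g : Function.End ℂ) curve T := fun hf hg => hf.comp hg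
  obtain ⟨r, z, hz, f, hfl, hfj, hr⟩ := exists_ray haff hA (T := leftPart 0)
    (fun z hz => (hcut.union z).2 (Or.inl hz))
    ((hpiece 0).mono <| by
      rintro _ ⟨w, hw, rfl⟩
      exact mem_leftPart.2 ⟨0, le_rfl, w, hw, rfl⟩)
  obtain ⟨r', z', hz', g, hgr, hgj, hr'⟩ := exists_ray haff hA (T := rightPart 0)
    (fun z hz => (hcut.union z).2 (Or.inr hz))
    ((hpiece 3).mono <| by
      rintro _ ⟨w, hw, rfl⟩
      exact mem_rightPart.2 ⟨3, by decide, w, hw, rfl⟩)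
  have hf : f ∈ F.semigroup := by simpa [hr 0] using (r.vertex 0).2
  have hg : g ∈ F.semigroup := by simpa [hr' 0] using (r'.vertex 0).2
  -- One value other than the junction decides the side of the whole image, and the powers, having
  -- `f` outermost, stay on that side.
  have hfl' : MapsTo f curve (leftPart 0) :=
    (mapsTo_side haff hA hf).resolve_right fun h => hfj (hcut.inter _ hfl (h hz))
  have hgr' : MapsTo g curve (rightPart 0) :=
    (mapsTo_side haff hA hg).resolve_left fun h => hgj (hcut.inter _ (h hz') hgr)
  have hiter : ∀ {f : Function.End ℂ}, f ∈ F.semigroup → ∀ n : ℕ, MapsTo (f ^ n) curve curve := by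
    intro f hf n
    induction n with
    | zero => exact mapsTo_id _
    | succ n ih =>
      rw [pow_succ']
      exact hsub (semigroup_properties haff hA hf).2.1 ih
  have hss : Subsingleton F.Ends := (Nat.card_eq_one_iff_unique.1 hone).1
  have heq : r.Equiv r' := Quotient.exact (s := F.raySetoid) (hss.elim _ _)
  obtain ⟨C, φ, ψ, -, -, hC, hC'⟩ := heq (cutVertices F) (finite_cutVertices F)
  have h1 : MapsTo (r.vertex (φ 0) : Function.End ℂ) curve (leftPart 0) := by
    rw [hr, pow_succ']
    exact hsub hfl' (hiter hf _)
  have h2 : MapsTo (r'.vertex (ψ 0) : Function.End ℂ) curve (rightPart 0) := by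
    rw [hr', pow_succ']
    exact hsub hgr' (hiter hg _)
  have h3 := (mapsTo_side_iff_of_mem haff hA (hC 0) (hC' 0)).1 h1
  obtain ⟨hnot, -⟩ := hC' 0
  obtain ⟨L, hL⟩ := (semigroup_properties haff hA (r'.vertex (ψ 0)).2).1
  exact hnot (eq_const_of_curve hL fun z hz => hcut.inter _ (h3 hz) (h2 hz))

end CrookedKoch

theorem theorem18 :
    (∀ f : ℂ → ℂ,
      (IsRealAffine f ∧ IsContractionOf CrookedKoch.curve f ∧ (f '' CrookedKoch.curve).Nontrivial) ↔
        f ∈ CrookedKoch.ifs.semigroup) ∧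
    ∀ F : IFS ℂ, (∀ f ∈ F.maps, IsRealAffine f) → F.attractor = CrookedKoch.curve →
      ¬ F.OneEnded :=
  ⟨CrookedKoch.mem_semigroup_iff_isContractionOf, fun _ => CrookedKoch.not_oneEnded_of_attractor_eq⟩
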